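/- Let $F\subseteq\mathbb C$ be a field (for example $F=\mathbb Q$), let $M=\mathrm J^1(\mathbb C,\mathbb C)$ with coordinates $(x,y,p)$, and for a rational function $f\in F(x,y,p)$ let $\mathcal E_f$ be the second order ODE $y''=f(x,y,y')$, with Cartan field $D_f=\partial_x+p\,\partial_y+f\,\partial_p$ spanning the line field $\Delta_f$ on $M$. Let $\Phi_1,\dots,\Phi_7$ be the groupoids of invertible point transformations $(x,y)\mapsto(\bar x,\bar y)$ (prolonged to $M$ by $\bar p=(\partial_x+p\,\partial_y)\bar y/(\partial_x+p\,\partial_y)\bar x$) of the following forms: $$\begin{array}{ll} \Phi_1:\ \bar x=x,\ \bar y=\eta(x,y); & \Phi_2:\ \bar x=\xi(x,y),\ \bar y=y;\\ \Phi_3:\ \bar x=x+C,\ \bar y=\eta(x,y); & \Phi_4:\ \bar x=\xi(x,y),\ \bar y=y+C;\\ \Phi_5:\ \bar x=\xi(x),\ \bar y=\eta(x,y); & \Phi_6:\ \bar x=\xi(x,y),\ \bar y=\eta(y);\\ \Phi_7:\ \bar x=\xi(x,y),\ \bar y=\eta(x,y). & \end{array}$$ Let $\operatorname{aut}(\mathcal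 E_f)$ be the contact symmetry groupoid of $\mathcal E_f$, i.e. the groupoid of invertible Taylor series of contact transformations of $M$ that preserve $\Delta_f$. Put $\mathrm d(\mathcal E_f,\Phi_i)=\dim(\operatorname{aut}(\mathcal E_f)\cap\Phi_i)$, where the dimension is the number of arbitrary constants in the Taylor series at a generic source point, that is, the transcendence degree over $k=F(x,y,p)$ of $k\{\bar x,\bar y,\bar p\}/\mathfrak c$, where $\mathfrak c$ is the radical differential ideal of the Lie defining equations, saturated by the inequation (the Jacobian determinant is nonzero and $f$ is defined at the target). With $\mathrm d_i=\mathrm d(\mathcal E_f,\Phi_i)$, the signature of $\mathcal E_f$ is $\operatorname{sign}(\mathcal E_f)=(s_1,s_2,\mathrm d_7)$ with $s_1=(\mathrm d_1,\mathrm d_3,\mathrm d_5)$ and $s_2=(\mathrm d_2,\mathrm d_4,\mathrm d_6)$. The signatures $(s_1,s_2,\mathrm d_7)$ and $(\bar s_1,\bar s_2,\bar{\mathrm d}_7)$ match if $\mathrm d_7=\bar{\mathrm d}_7$ and ($s_1=\bar s_1$ or $s_2=\bar s_2$). Let $f,\bar f\in F(x,y,p)$, and suppose that $\mathcal E_f$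 and $\mathcal E_{\bar f}$ are strongly equivalent: there are $i\in\{1,\dots,7\}$ and a local analytic diffeomorphism $\varphi$ in the prolongation of $\Phi_i$, defined on a nonempty open subset of $M$ on which $f$ and $\bar f\circ\varphi$ are defined, such that $\varphi_*\Delta_f=\Delta_{\bar f}$ and $\mathrm d(\mathcal E_{\bar f},\Phi_i)=0$. Then $\operatorname{sign}(\mathcal E_f)$ and $\operatorname{sign}(\mathcal E_{\bar f})$ match. -/

import Mathlib

/-! Second order equations `y'' = f(x, y, y')` with `f` a rational function over a field `F ⊆ ℂ`,
their symmetry groupoids inside seven groupoids of point transformations, and signatures.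

The space `M = J¹(ℂ, ℂ)` has the coordinates `(x, y, p)`, numbered `0, 1, 2`. -/

namespace SecondOrderODE

universe u

section DifferentialAlgebra

variable (F : Type u) [Field F]

/-- The field of coefficients `k = F(x, y, p)`. -/
abbrev RatFun : Type u := FractionRing (MvPolynomial (Fin 3) F)

/-- The ring of differential polynomials `k{x̄, ȳ, p̄}`: the variable `(u, α)` is the derivative
`∂ₓ^{α 0} ∂_y^{α 1} ∂_p^{α 2}` of the indeterminate number `u` (`x̄`, `ȳ`, `p̄` for `u = 0, 1, 2`). -/
abbrev DiffPoly : Type u := MvPolynomial (Fin 3 × (Fin 3 →₀ ℕ)) (RatFun F)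

variable {F}

/-- The numerator of a rational function (in lowest terms). -/
noncomputable def numer (f : RatFun F) : MvPolynomial (Fin 3) F :=
  IsFractionRing.num (MvPolynomial (Fin 3) F) f

/-- The denominator of a rational function (in lowest terms). -/
noncomputable def denom (f : RatFun F) : MvPolynomial (Fin 3) F :=
  (IsFractionRing.den (MvPolynomial (Fin 3) F) f : MvPolynomial (Fin 3) F)

/-- The partial derivative of a rational function, by the quotient rule. -/
noncomputable def ratDeriv (j : Fin 3) (f : RatFun F) : RatFun F :=
  algebraMap _ (RatFun F)
      (MvPolynomial.pderiv j (numer f) * denom f - numer f * MvPolynomial.pderiv j (denom f)) /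
    algebraMap _ (RatFun F) (denom f) ^ 2

/-- The derivation of `k{x̄, ȳ, p̄}` that extends the partial derivative number `j` of `k`: it
differentiates the coefficients and sends the variable `(u, α)` to `(u, α + e_j)`. -/
noncomputable def diffPolyDeriv (j : Fin 3) (q : DiffPoly F) : DiffPoly F :=
  ∑ m ∈ q.support, MvPolynomial.monomial m (ratDeriv j (MvPolynomial.coeff m q)) +
    MvPolynomial.mkDerivation (RatFun F)
      (fun v : Fin 3 × (Fin 3 →₀ ℕ) =>
        (MvPolynomial.X (v.1, v.2 + Finsupp.single j 1) : DiffPoly F)) q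

/-- The differential ideal `[E]` generated by a set `E` of differential polynomials. -/
noncomputable def diffIdeal (E : Set (DiffPoly F)) : Ideal (DiffPoly F) :=
  sInf {I | E ⊆ I ∧ ∀ j, ∀ q ∈ I, diffPolyDeriv j q ∈ I}

end DifferentialAlgebra

/-- The saturation `I : h^∞`. -/
def saturation {R : Type*} [CommRing R] (I : Ideal R) (h : R) : Ideal R where
  carrier := {q | ∃ n : ℕ, h ^ n * q ∈ I}
  add_mem' := by
    rintro a b ⟨n, hn⟩ ⟨m, hm⟩
    refine ⟨n + m, ?_⟩
    have e : h ^ (n + m) * (a + b) = h ^ m * (h ^ n * a) + h ^ n * (h ^ m * b) := by ring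
    rw [e]
    exact I.add_mem (I.mul_mem_left _ hn) (I.mul_mem_left _ hm)
  zero_mem' := ⟨0, by simp⟩
  smul_mem' := by
    rintro c a ⟨n, hn⟩
    refine ⟨n, ?_⟩
    have e : h ^ n * (c • a) = c * (h ^ n * a) := by rw [smul_eq_mul]; ring
    rw [e]
    exact I.mul_mem_left _ hn

/-- The names of the seven groupoids `Φ₁, …, Φ₇` of point transformations
`(x, y) ↦ (x̄, ȳ)`. -/
inductive GroupoidIndex where
  | phi1 | phi2 | phi3 | phi4 | phi5 | phi6 | phi7

/-- The Lie defining equations of `Φᵢ` on the plane, apart from the invertibility condition: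
* `Φ₁`: `x̄ = x`, `ȳ = η(x, y)`;      `Φ₂`: `x̄ = ξ(x, y)`, `ȳ = y`;
* `Φ₃`: `x̄ = x + C`, `ȳ = η(x, y)`;  `Φ₄`: `x̄ = ξ(x, y)`, `ȳ = y + C`;
* `Φ₅`: `x̄ = ξ(x)`, `ȳ = η(x, y)`;   `Φ₆`: `x̄ = ξ(x, y)`, `ȳ = η(y)`;
* `Φ₇`: `x̄ = ξ(x, y)`, `ȳ = η(x, y)`.

Here `b` is the source point, `t` the target point, and `J u j` the partial derivative number `j`
of the target coordinate number `u`; the equations are that all elements of the set vanish. -/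
def planeEqns {A : Type*} [CommRing A] (i : GroupoidIndex) (b t : Fin 3 → A)
    (J : Fin 3 → Fin 3 → A) : Set A :=
  match i with
  | .phi1 => {t 0 - b 0}
  | .phi2 => {t 1 - b 1}
  | .phi3 => {J 0 0 - 1, J 0 1}
  | .phi4 => {J 1 0, J 1 1 - 1}
  | .phi5 => {J 0 1}
  | .phi6 => {J 1 0}
  | .phi7 => ∅

/-- The Lie defining equations of the prolongation of `Φᵢ` to `M`: `x̄` and `ȳ` do not depend on
`p`, they satisfy the equations of `Φᵢ`, and `p̄ · Dx̄ = Dȳ` with `D = ∂ₓ + p ∂_y`. -/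
def prolongedEqns {A : Type*} [CommRing A] (i : GroupoidIndex) (b t : Fin 3 → A)
    (J : Fin 3 → Fin 3 → A) : Set A :=
  {J 0 2, J 1 2, t 2 * (J 0 0 + b 2 * J 0 1) - (J 1 0 + b 2 * J 1 1)} ∪ planeEqns i b t J

section Symmetries

variable {F : Type u} [Field F]

/-- The coordinates of the source point as elements of `k{x̄, ȳ, p̄}`. -/
noncomputable def srcCoord (j : Fin 3) : DiffPoly F :=
  MvPolynomial.C (algebraMap (MvPolynomial (Fin 3) F) (RatFun F) (MvPolynomial.X j))

/-- The differential indeterminates `x̄, ȳ, p̄`. -/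
noncomputable def tgtCoord (u : Fin 3) : DiffPoly F := MvPolynomial.X (u, 0)

/-- The first derivatives of `x̄, ȳ, p̄`. -/
noncomputable def tgtJac (u j : Fin 3) : DiffPoly F := diffPolyDeriv j (tgtCoord u)

/-- A polynomial in `x, y, p`, evaluated at `x̄, ȳ, p̄`. -/
noncomputable def atTarget (P : MvPolynomial (Fin 3) F) : DiffPoly F :=
  MvPolynomial.aeval (fun u => (tgtCoord u : DiffPoly F)) P

/-- The Cartan field `D_f = ∂ₓ + p ∂_y + f ∂_p`, applied to a target coordinate. -/
noncomputable def cartanTgt (f : RatFun F) (u : Fin 3) : DiffPoly F :=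
  tgtJac u 0 + srcCoord 2 * tgtJac u 1 + MvPolynomial.C f * tgtJac u 2

/-- The Lie defining equations of the contact symmetry groupoid `aut(E_f)` of `y'' = f(x, y, y')`,
apart from the invertibility condition: the contact form `dȳ - p̄ dx̄` is proportional to
`dy - p dx` (its values on `∂_p` and on `∂ₓ + p ∂_y` vanish), and the direction of `D_f` is mapped
to the direction of `D_f` at the target, `D_f ȳ = p̄ · D_f x̄` and
`D_f p̄ = f(x̄, ȳ, p̄) · D_f x̄` (the denominator of `f` is cleared). -/
noncomputable def autEqns (f : RatFun F) : Set (DiffPoly F) :=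
  {tgtJac 1 2 - tgtCoord 2 * tgtJac 0 2,
   (tgtJac 1 0 + srcCoord 2 * tgtJac 1 1) - tgtCoord 2 * (tgtJac 0 0 + srcCoord 2 * tgtJac 0 1),
   cartanTgt f 1 - tgtCoord 2 * cartanTgt f 0,
   atTarget (denom f) * cartanTgt f 2 - atTarget (numer f) * cartanTgt f 0}

/-- The inequation: the jets are invertible, and `f` is defined at the target. -/
noncomputable def inequation (f : RatFun F) : DiffPoly F :=
  Matrix.det (Matrix.of fun u j : Fin 3 => (tgtJac u j : DiffPoly F)) * atTarget (denom f)

/-- The differential ideal of `aut(E_f) ∩ Φᵢ`: the differential polynomials that vanish on all its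
Taylor series. It is the radical differential ideal generated by the Lie defining equations,
saturated by the inequation. -/
noncomputable def symIdeal (f : RatFun F) (i : GroupoidIndex) : Ideal (DiffPoly F) :=
  saturation (diffIdeal (autEqns f ∪ prolongedEqns i srcCoord tgtCoord tgtJac)).radical
    (inequation f)

/-- `d(E_f, Φᵢ) = dim (aut(E_f) ∩ Φᵢ)`, the number of arbitrary constants in the Taylor series
of the groupoid at a given generic source point: the transcendence degree over `k = F(x, y, p)` of
the residue ring of the differential ideal. (If that ideal is not prime, this is the largest
transcendence degree of the residue field of a minimal prime over it.) It is kept as a cardinal, so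
that an infinite dimension is not confused with `0`. -/
noncomputable def symDim (f : RatFun F) (i : GroupoidIndex) : Cardinal.{u} :=
  Algebra.trdeg (RatFun F) (DiffPoly F ⧸ symIdeal f i)

/-- The signature `((d₁, d₃, d₅), (d₂, d₄, d₆), d₇)` of `E_f`. -/
noncomputable def signature (f : RatFun F) :
    (Cardinal.{u} × Cardinal.{u} × Cardinal.{u}) × (Cardinal.{u} × Cardinal.{u} × Cardinal.{u}) ×
      Cardinal.{u} :=
  ((symDim f .phi1, symDim f .phi3, symDim f .phi5),
   (symDim f .phi2, symDim f .phi4, symDim f .phi6),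
   symDim f .phi7)

end Symmetries

/-- Two signatures `(s₁, s₂, d₇)` and `(s̄₁, s̄₂, d̄₇)` match if `d₇ = d̄₇` and
(`s₁ = s̄₁` or `s₂ = s̄₂`). -/
def SignaturesMatch {S D : Type*} (s t : S × S × D) : Prop :=
  s.2.2 = t.2.2 ∧ (s.1 = t.1 ∨ s.2.1 = t.2.1)

section Equivalence

variable {F : Type u} [Field F] [Algebra F ℂ]

/-- The value of a rational function at a point of `M` (meaningful where it is defined). -/
noncomputable def evalAt (f : RatFun F) (v : Fin 3 → ℂ) : ℂ :=
  MvPolynomial.aeval v (numer f) / MvPolynomial.aeval v (denom f)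

/-- The rational function is defined at the point `v`. -/
def IsDefinedAt (f : RatFun F) (v : Fin 3 → ℂ) : Prop :=
  MvPolynomial.aeval v (denom f) ≠ 0

/-- The line `Δ_f` at the point `v` of `M`, spanned by the Cartan field
`D_f = ∂ₓ + p ∂_y + f ∂_p`. -/
noncomputable def cartanLine (f : RatFun F) (v : Fin 3 → ℂ) : Submodule ℂ (Fin 3 → ℂ) :=
  Submodule.span ℂ {![1, v 2, evalAt f v]}

/-- `φ`, on the nonempty open set `V` of `M`, is a local analytic diffeomorphism in the
prolongation of `Φᵢ` to `M`, and it maps `E_f` to `E_g`: `φ_*(Δ_f) = Δ_g`. -/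
structure IsLocalEquivalence (i : GroupoidIndex) (f g : RatFun F) (V : Set (Fin 3 → ℂ))
    (φ : (Fin 3 → ℂ) → (Fin 3 → ℂ)) : Prop where
  isOpen : IsOpen V
  nonempty : V.Nonempty
  analytic : AnalyticOnNhd ℂ φ V
  invertible : ∀ v ∈ V, (fderiv ℂ φ v).det ≠ 0
  mem_groupoid : ∀ v ∈ V,
    ∀ e ∈ prolongedEqns i v (φ v) (fun u j => fderiv ℂ φ v (Pi.single j 1) u), e = 0
  defined_source : ∀ v ∈ V, IsDefinedAt f v
  defined_target : ∀ v ∈ V, IsDefinedAt g (φ v)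
  map_line : ∀ v ∈ V,
    (cartanLine f v).map (fderiv ℂ φ v : (Fin 3 → ℂ) →ₗ[ℂ] (Fin 3 → ℂ)) = cartanLine g (φ v)

/-- `E_f` and `E_g` are strongly equivalent: for some `i`, some local transformation in `Φᵢ` maps
`E_f` to `E_g`, and `d(E_g, Φᵢ) = 0`. -/
def StronglyEquivalent (f g : RatFun F) : Prop :=
  ∃ i : GroupoidIndex, (∃ V φ, IsLocalEquivalence i f g V φ) ∧ symDim g i = 0

end Equivalence

end SecondOrderODE

/-! Let `φ` in the prolongation of `Φᵢ` map `E_f` to `E_g`, where `g` stands for `f̄`. For every `Φⱼ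
⊇ Φᵢ`, conjugation by `φ` should identify the two symmetry groupoids inside `Φⱼ`, so `dⱼ` is the
same for both equations; in particular `dᵢ = 0` for both. For every `Φⱼ ⊆ Φᵢ`, monotonicity of
dimension makes both `dⱼ` zero. Each of `Φ₁ ⊂ Φ₃ ⊂ Φ₅ ⊂ Φ₇` and `Φ₂ ⊂ Φ₄ ⊂ Φ₆ ⊂ Φ₇` is a chain, so
the chain through `Φᵢ` yields the equal triple, and `d₇` agrees because `Φ₇` contains everything.

The work lies in the invariance of `dⱼ`, because it is defined by differential ideals over `F(x, y,
p)` whereas `φ` is only analytic over `ℂ`. Both sides are compared through models: a `Frame` is a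
field with three commuting derivations and coordinates `s`, and a model is a tuple `t` in it that
solves the equations of a transformation from `E_f` to `E_g`. The bounds `IsModel.totalDim_le` and
`exists_isModel_totalDim_ge` show that `3 + isoDim f g i` is governed by the transcendence degrees
over `F` of the fields generated by `s` and the jets of `t`; models of large degree are Taylor
expansions at generic points of the differential ideal.

Exchanging `s` and `t` keeps the generated field, whence `isoDim_le_swap`. Composing a model with
the inverse of one fixed model of `E_f → E_g`, after embedding both independently in a common field,
gives `isoDim_le_of_isModel`. Hence `d(f,f) ≤ d(g,f) ≤ d(f,g) ≤ d(g,g)`, and the inverse model gives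
the converse. Finally `φ` itself supplies the fixed model by Taylor expansion at a point of its
domain (`exists_isModel_of_isLocalEquivalence`). -/

namespace SecondOrderODE

open Cardinal MvPolynomial

universe u

/-! ### Transcendence degree of subsets of a field, through the algebraic independence matroid. -/

section TranscendenceRank

variable (k : Type*) {N : Type*} [Field k] [Field N] [Algebra k N]

/-- The algebraic closure of a set inside a field extension. -/
noncomputable abbrev algClosure (X : Set N) : Set N :=
  (AlgebraicIndependent.matroid k N).closure X

/-- The transcendence degree over `k` of the field generated by a set. -/
noncomputable abbrev algRank (X : Set N) : Cardinal := (AlgebraicIndependent.matroid k N).cRk X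

theorem subset_algClosure (X : Set N) : X ⊆ algClosure k X :=
  (AlgebraicIndependent.matroid k N).subset_closure X (Set.subset_univ _)

/-- Flats of the matroid are the algebraically closed subalgebras; this lets membership in a closure
be checked by ring operations. -/
theorem exists_subalgebra_eq_algClosure (X : Set N) :
    ∃ S : Subalgebra k N, (S : Set N) = algClosure k X ∧ ∀ a : N, IsAlgebraic S a → a ∈ S := by
  obtain ⟨S, hS, h⟩ := AlgebraicIndependent.matroid_isFlat_iff.mp
    ((AlgebraicIndependent.matroid k N).isFlat_closure X)
  refine ⟨S, hS, fun a ha => ?_⟩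
  have := h a ha
  rwa [← hS] at this

variable {k}

/-- The two base fields need not be comparable: it is enough that the constants of `k'` are
algebraic over `k(X)`. -/
theorem algClosure_subset_of_subset {k' : Type*} [Field k'] [Algebra k' N] {X Y : Set N}
    (hk : Set.range (algebraMap k' N) ⊆ algClosure k X) (hY : Y ⊆ algClosure k X) :
    algClosure k' Y ⊆ algClosure k X := by
  obtain ⟨S, hS, hal⟩ := exists_subalgebra_eq_algClosure k X
  rw [← hS] at hk hY ⊢
  intro a ha
  rw [algClosure, AlgebraicIndependent.matroid_closure_eq] at ha
  have ha' : IsAlgebraic (Algebra.adjoin k' Y) a := ha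
  apply hal
  have hle : ∀ z ∈ Algebra.adjoin k' Y, z ∈ S := by
    intro z hz
    induction hz using Algebra.adjoin_induction with
    | mem x hx => exact hY hx
    | algebraMap r => exact hk ⟨r, rfl⟩
    | add x y _ _ hx hy => exact S.add_mem hx hy
    | mul x y _ _ hx hy => exact S.mul_mem hx hy
  let i : Algebra.adjoin k' Y →+* S :=
    { toFun := fun z => ⟨z.1, hle z.1 z.2⟩
      map_one' := rfl, map_mul' := fun _ _ => rfl
      map_zero' := rfl, map_add' := fun _ _ => rfl }
  exact ha'.ringHom_of_comp_eq i (RingHom.id N)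
    (fun x y h => Subtype.ext (congrArg Subtype.val h :)) rfl

theorem range_algebraMap_subset_algClosure (X : Set N) :
    Set.range (algebraMap k N) ⊆ algClosure k X := by
  obtain ⟨S, hS, -⟩ := exists_subalgebra_eq_algClosure k X
  rw [← hS]
  rintro _ ⟨r, rfl⟩
  exact S.algebraMap_mem r

theorem algClosure_mono {X Y : Set N} (h : X ⊆ Y) : algClosure k X ⊆ algClosure k Y :=
  (AlgebraicIndependent.matroid k N).closure_subset_closure h

theorem algRank_mono {X Y : Set N} (h : X ⊆ Y) : algRank k X ≤ algRank k Y :=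
  (AlgebraicIndependent.matroid k N).cRk_le_of_subset h

theorem algRank_le_of_subset_algClosure {X Y : Set N} (h : Y ⊆ algClosure k X) :
    algRank k Y ≤ algRank k X :=
  (algRank_mono h).trans (Matroid.cRk_closure _ X).le

theorem adjoin_subset_algClosure (X : Set N) :
    (IntermediateField.adjoin k X : Set N) ⊆ algClosure k X := by
  obtain ⟨S, hS, hal⟩ := exists_subalgebra_eq_algClosure k X
  have hX := subset_algClosure k X
  rw [← hS] at hX ⊢
  intro z hz
  induction hz using IntermediateField.adjoin_induction with
  | mem x hx => exact hX hx
  | algebraMap r => exact S.algebraMap_mem r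
  | add x y _ _ hx hy => exact S.add_mem hx hy
  | mul x y _ _ hx hy => exact S.mul_mem hx hy
  | inv x _ hx => exact hal _ (isAlgebraic_algebraMap (⟨x, hx⟩ : S)).inv

theorem exists_subset_algebraicIndependent_of_algRank (X : Set N) :
    ∃ B ⊆ X, AlgebraicIndependent k ((↑) : B → N) ∧ X ⊆ algClosure k B ∧ #B = algRank k X := by
  obtain ⟨B, hB⟩ := (AlgebraicIndependent.matroid k N).exists_isBasis X (Set.subset_univ _)
  exact ⟨B, hB.subset, hB.indep, hB.subset_closure, hB.cardinalMk_eq_cRk⟩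

theorem cardinalMk_le_algRank {X B : Set N} (hB : AlgebraicIndependent k ((↑) : B → N))
    (h : B ⊆ X) : #B ≤ algRank k X :=
  Matroid.Indep.cardinalMk_le_cRk_of_subset (M := AlgebraicIndependent.matroid k N) hB h

/-- Enlarging the field of constants can only lower a transcendence degree. Only the images in `N`
are compared, so no map between the two base fields is needed. -/
theorem algRank_le_of_tower (K : Type*) [Field K] [Algebra K N] (k' : Type*) [Field k']
    [Algebra k' N] (h : Set.range (algebraMap k' N) ⊆ Set.range (algebraMap K N)) (X : Set N) :
    algRank K X ≤ algRank k' X := by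
  obtain ⟨B, -, -, hXB, hc⟩ := exists_subset_algebraicIndependent_of_algRank (k := k') X
  rw [← hc]
  refine (algRank_le_of_subset_algClosure (X := B) ?_).trans (Matroid.cRk_le_cardinalMk _ _)
  exact hXB.trans (algClosure_subset_of_subset
    (h.trans (range_algebraMap_subset_algClosure _)) (subset_algClosure K B))

/-- Additivity of transcendence degree in the tower `F ⊆ k ⊆ k(Y)`: a basis of `Y` over `k` joined
with `x` is independent over `F`, and `k` is algebraic over `F(x)`. -/
theorem algRank_union_range {k : Type*} [Field k] {N : Type*} [Field N] {F : Type*} [Field F]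
    [Algebra F k] [Algebra k N] [Algebra F N] [IsScalarTower F k N] {n : ℕ} {x : Fin n → k}
    (hx : IsTranscendenceBasis F x) (Y : Set N) :
    algRank F (Set.range (algebraMap k N ∘ x) ∪ Y) = n + algRank k Y := by
  obtain ⟨B, hBY, hB, hYB, hc⟩ := exists_subset_algebraicIndependent_of_algRank (k := k) Y
  have hind := hx.1.sumElim_comp hB
  have hrange : Set.range (Sum.elim ((↑) : B → N) (algebraMap k N ∘ x)) =
      B ∪ Set.range (algebraMap k N ∘ x) := by rw [Set.Sum.elim_range, Subtype.range_coe]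
  have hcard : #(B ∪ Set.range (algebraMap k N ∘ x) : Set N) = n + #B := by
    have := Cardinal.mk_range_eq_of_injective hind.injective
    rw [hrange] at this
    have h2 := congrArg Cardinal.lift.{0} this
    simp only [Cardinal.lift_id, Cardinal.lift_uzero, Cardinal.mk_sum, Cardinal.mk_fin] at this h2
    simpa [add_comm] using this
  rw [← hc, ← hcard]
  apply le_antisymm
  · refine (algRank_le_of_subset_algClosure (X := B ∪ Set.range (algebraMap k N ∘ x)) ?_).trans
      (Matroid.cRk_le_cardinalMk _ _)
    refine Set.union_subset
      (Set.subset_union_right.trans (subset_algClosure F _)) (hYB.trans ?_)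
    refine algClosure_subset_of_subset ?_ (Set.subset_union_left.trans (subset_algClosure F _))
    rintro _ ⟨r, rfl⟩
    have h1 := hx.isAlgebraic.1 r
    have h2 : algebraMap k N r ∈ algClosure F (Set.range (algebraMap k N ∘ x)) := by
      rw [algClosure, AlgebraicIndependent.matroid_closure_eq]
      change IsAlgebraic (Algebra.adjoin F (Set.range (algebraMap k N ∘ x))) (algebraMap k N r)
      have hmem : ∀ z ∈ Algebra.adjoin F (Set.range x), algebraMap k N z ∈
          Algebra.adjoin F (Set.range (algebraMap k N ∘ x)) := by
        intro z hz
        rw [Set.range_comp]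
        have := AlgHom.map_adjoin (IsScalarTower.toAlgHom F k N) (Set.range x)
        rw [IsScalarTower.coe_toAlgHom'] at this
        rw [← this]
        exact ⟨z, hz, rfl⟩
      let i : Algebra.adjoin F (Set.range x) →+*
          Algebra.adjoin F (Set.range (algebraMap k N ∘ x)) :=
        { toFun := fun z => ⟨algebraMap k N z.1, hmem z.1 z.2⟩
          map_one' := Subtype.ext (map_one (algebraMap k N))
          map_mul' := fun _ _ => Subtype.ext (map_mul (algebraMap k N) _ _)
          map_zero' := Subtype.ext (map_zero (algebraMap k N))
          map_add' := fun _ _ => Subtype.ext (map_add (algebraMap k N) _ _) }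
      exact h1.ringHom_of_comp_eq i (algebraMap k N)
        (fun a b h => Subtype.ext ((algebraMap k N).injective (congrArg Subtype.val h :))) rfl
    exact algClosure_mono Set.subset_union_right h2
  · have := hind.coe_range
    rw [hrange] at this
    refine cardinalMk_le_algRank this ?_
    exact Set.union_subset (hBY.trans Set.subset_union_right) Set.subset_union_left

end TranscendenceRank

/-! ### Derivations of fraction fields. -/

section Derivations

variable {F : Type*} [Field F]

theorem derivation_eq_of_eq_on_fractionRing {A K M : Type*} [CommRing A] [IsDomain A] [Field K]
    [Field M] [Algebra A K] [IsFractionRing A K] [Algebra F M] [Algebra F K]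
    (g : K →+* M) (D : Derivation F K K) (E : Derivation F M M)
    (h : ∀ a : A, g (D (algebraMap A K a)) = E (g (algebraMap A K a))) (z : K) :
    g (D z) = E (g z) := by
  obtain ⟨a, b, -, rfl⟩ := IsFractionRing.div_surjective (A := A) z
  simp only [map_div₀, Derivation.leibniz_div, smul_eq_mul, map_mul, map_pow, map_inv₀, map_sub, h]

/-- The commutator is again a derivation, and by the quotient rule a derivation that vanishes on `A`
vanishes on its fraction field. -/
theorem commute_of_commute_on_fractionRing {A K : Type*} [CommRing A] [IsDomain A] [Field K]
    [Algebra A K] [IsFractionRing A K] [Algebra F K] (D E : Derivation F K K)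
    (h : ∀ a : A, D (E (algebraMap A K a)) = E (D (algebraMap A K a))) (z : K) :
    D (E z) = E (D z) := by
  have h0 : ⁅D, E⁆ z = (0 : Derivation F K K) z := by
    have := derivation_eq_of_eq_on_fractionRing (A := A) (RingHom.id K) ⁅D, E⁆ 0
      (fun a => by simp [Derivation.commutator_apply, h]) z
    simpa using this
  rw [Derivation.commutator_apply, Derivation.zero_apply, sub_eq_zero] at h0
  exact h0

/-- The extension of a derivation to the fraction field, as a homomorphism to the dual numbers. -/
noncomputable def fractionDual {A : Type*} [CommRing A] [IsDomain A] [Algebra F A]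
    (D : Derivation F A A) :
    FractionRing A →+* TrivSqZeroExt (FractionRing A) (FractionRing A) :=
  IsLocalization.lift (M := nonZeroDivisors A)
    (g := { toFun := fun a => TrivSqZeroExt.inl (algebraMap A (FractionRing A) a) +
              TrivSqZeroExt.inr (algebraMap A (FractionRing A) (D a))
            map_one' := by simp
            map_mul' := fun a b => by
              ext <;> simp only [TrivSqZeroExt.snd_add, TrivSqZeroExt.snd_mul, TrivSqZeroExt.fst_add, TrivSqZeroExt.fst_mul,
                TrivSqZeroExt.fst_inl, TrivSqZeroExt.snd_inl, TrivSqZeroExt.fst_inr, TrivSqZeroExt.snd_inr, map_add, map_mul, smul_eq_mul, MulOpposite.smul_eq_mul_unop, MulOpposite.unop_op, Derivation.leibniz, add_zero, zero_add]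
              ring
            map_zero' := by simp
            map_add' := fun a b => by
              ext <;> simp only [TrivSqZeroExt.snd_add, TrivSqZeroExt.fst_add, TrivSqZeroExt.fst_inl,
                TrivSqZeroExt.snd_inl, TrivSqZeroExt.fst_inr, TrivSqZeroExt.snd_inr, map_add,
                add_zero, zero_add] })
    (fun b => by
      rw [TrivSqZeroExt.isUnit_iff_isUnit_fst]
      simp)

theorem fractionDual_algebraMap {A : Type*} [CommRing A] [IsDomain A] [Algebra F A]
    (D : Derivation F A A) (a : A) :
    fractionDual D (algebraMap A (FractionRing A) a) =
      TrivSqZeroExt.inl (algebraMap A (FractionRing A) a) +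
              TrivSqZeroExt.inr (algebraMap A (FractionRing A) (D a)) := by
  simp only [fractionDual, IsLocalization.lift_eq]
  rfl

theorem fractionDual_fst {A : Type*} [CommRing A] [IsDomain A] [Algebra F A]
    (D : Derivation F A A) (z : FractionRing A) : (fractionDual D z).fst = z := by
  have : ((TrivSqZeroExt.fstHom (FractionRing A) (FractionRing A) (FractionRing A)).toRingHom.comp
      (fractionDual D)) = RingHom.id _ := by
    apply IsLocalization.ringHom_ext (nonZeroDivisors A)
    ext a
    simp [fractionDual_algebraMap]
  exact congrArg (fun f => f z) this

/-- The extension of a derivation to the fraction field. -/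
noncomputable def fractionDerivation {A : Type*} [CommRing A] [IsDomain A] [Algebra F A]
    (D : Derivation F A A) : Derivation F (FractionRing A) (FractionRing A) :=
  Derivation.mk'
    { toFun := fun z => (fractionDual D z).snd
      map_add' := fun a b => by simp
      map_smul' := fun c a => by
        have : c • a = algebraMap A (FractionRing A) (algebraMap F A c) * a := by
          rw [Algebra.smul_def, IsScalarTower.algebraMap_apply F A (FractionRing A)]
        rw [this, map_mul, TrivSqZeroExt.snd_mul, fractionDual_algebraMap]
        simp [Algebra.smul_def, ← IsScalarTower.algebraMap_apply] }
    (fun a b => by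
      simp [fractionDual_fst, mul_comm])

@[simp]
theorem fractionDerivation_algebraMap {A : Type*} [CommRing A] [IsDomain A] [Algebra F A]
    (D : Derivation F A A) (a : A) :
    fractionDerivation D (algebraMap A (FractionRing A) a) =
      algebraMap A (FractionRing A) (D a) := by
  change (fractionDual D _).snd = _
  rw [fractionDual_algebraMap, TrivSqZeroExt.snd_add, TrivSqZeroExt.snd_inl,
    TrivSqZeroExt.snd_inr, zero_add]

end Derivations

/-! ### Iterated partial derivatives. -/

section Iterated

variable {F R : Type*} [Field F] [CommRing R] [Algebra F R]

/-- The iterated derivative `d₀^{α 0} d₁^{α 1} d₂^{α 2}`. -/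
noncomputable def iterDeriv (d : Fin 3 → Derivation F R R) (α : Fin 3 →₀ ℕ) : Module.End F R :=
  (d 0 : Module.End F R) ^ α 0 * (d 1 : Module.End F R) ^ α 1 * (d 2 : Module.End F R) ^ α 2

variable {d : Fin 3 → Derivation F R R}

@[simp]
theorem iterDeriv_zero (x : R) : iterDeriv d 0 x = x := by
  simp [iterDeriv]

theorem iterDeriv_add_single (hd : ∀ i j x, d i (d j x) = d j (d i x)) (α : Fin 3 →₀ ℕ) (j : Fin 3)
    (x : R) : iterDeriv d (α + Finsupp.single j 1) x = iterDeriv d α (d j x) := by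
  have hc : ∀ i j : Fin 3, Commute (d i : Module.End F R) (d j : Module.End F R) :=
    fun i j => LinearMap.ext fun x => hd i j x
  have key : iterDeriv d (α + Finsupp.single j 1) = iterDeriv d α * (d j : Module.End F R) := by
    unfold iterDeriv
    fin_cases j
    · simp only [Finsupp.add_apply, Fin.zero_eta, Finsupp.single_eq_same, ne_eq, not_false_eq_true, Finsupp.single_eq_of_ne, add_zero,
        pow_succ, Fin.isValue, show (2 : Fin 3) ≠ 0 by decide, show (1 : Fin 3) ≠ 0 by decide]
      rw [mul_assoc _ _ (d 0 : Module.End F R), ((hc 2 0).pow_left _).eq, ← mul_assoc,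
        mul_assoc _ _ (d 0 : Module.End F R), ((hc 1 0).pow_left _).eq, ← mul_assoc]
    · simp only [Finsupp.add_apply, Fin.mk_one, Finsupp.single_eq_same, ne_eq, not_false_eq_true, Finsupp.single_eq_of_ne, add_zero,
        pow_succ, Fin.isValue, show (2 : Fin 3) ≠ 1 by decide, show (0 : Fin 3) ≠ 1 by decide]
      rw [mul_assoc _ _ (d 1 : Module.End F R), ((hc 2 1).pow_left _).eq, ← mul_assoc, ← mul_assoc]
    · simp [Finsupp.add_apply, pow_succ, mul_assoc]
  rw [key]
  rfl

theorem iterDeriv_deriv (hd : ∀ i j x, d i (d j x) = d j (d i x)) (α : Fin 3 →₀ ℕ) (j : Fin 3)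
    (x : R) : d j (iterDeriv d α x) = iterDeriv d α (d j x) := by
  have hc : ∀ i j : Fin 3, Commute (d i : Module.End F R) (d j : Module.End F R) :=
    fun i j => LinearMap.ext fun x => hd i j x
  have : Commute (d j : Module.End F R) (iterDeriv d α) :=
    (((hc j 0).pow_right _).mul_right ((hc j 1).pow_right _)).mul_right ((hc j 2).pow_right _)
  exact LinearMap.congr_fun this.eq x

theorem iterDeriv_add_single' (hd : ∀ i j x, d i (d j x) = d j (d i x)) (α : Fin 3 →₀ ℕ)
    (j : Fin 3) (x : R) : iterDeriv d (α + Finsupp.single j 1) x = d j (iterDeriv d α x) := by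
  rw [iterDeriv_add_single hd, iterDeriv_deriv hd]

theorem eq_add_single_of_ne_zero {α : Fin 3 →₀ ℕ} (h : α ≠ 0) :
    ∃ β j, α = β + Finsupp.single j 1 := by
  obtain ⟨j, hj⟩ := Finsupp.ne_iff.mp h
  refine ⟨α - Finsupp.single j 1, j, (tsub_add_cancel_of_le ?_).symm⟩
  simpa [Finsupp.single_le_iff, Nat.one_le_iff_ne_zero] using hj

theorem multiindex_induction {P : (Fin 3 →₀ ℕ) → Prop} (h0 : P 0)
    (hs : ∀ β j, P β → P (β + Finsupp.single j 1)) (α : Fin 3 →₀ ℕ) : P α := by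
  induction h : α.degree generalizing α with
  | zero =>
    rw [(Finsupp.degree_eq_zero_iff α).mp h]
    exact h0
  | succ n ih =>
    have hα : α ≠ 0 := by rintro rfl; simp at h
    obtain ⟨β, j, rfl⟩ := eq_add_single_of_ne_zero hα
    exact hs β j (ih β (by simpa using h))

theorem iterDeriv_mem_of_closed (hd : ∀ i j x, d i (d j x) = d j (d i x)) {S : Set R}
    (hS : ∀ j, ∀ x ∈ S, d j x ∈ S) {x : R} (hx : x ∈ S) (α : Fin 3 →₀ ℕ) :
    iterDeriv d α x ∈ S := by
  induction α using multiindex_induction with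
  | h0 => simpa using hx
  | hs β j ih =>
    rw [iterDeriv_add_single' hd]
    exact hS j _ ih

theorem map_iterDeriv {R' : Type*} [CommRing R'] [Algebra F R'] {d' : Fin 3 → Derivation F R' R'}
    (hd : ∀ i j x, d i (d j x) = d j (d i x)) (hd' : ∀ i j x, d' i (d' j x) = d' j (d' i x))
    (T : R →+* R') (hT : ∀ j x, T (d j x) = d' j (T x)) (α : Fin 3 →₀ ℕ) (x : R) :
    T (iterDeriv d α x) = iterDeriv d' α (T x) := by
  induction α using multiindex_induction with
  | h0 => simp
  | hs β j ih => rw [iterDeriv_add_single' hd, iterDeriv_add_single' hd', hT, ih]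

end Iterated

/-! ### Taylor expansion along commuting derivations. -/

section Taylor

variable {F R L : Type*} [Field F] [CommRing R] [Algebra F R] [Field L] [Algebra F L]

/-- The Taylor expansion of `x` along commuting derivations, at the point `ev`. -/
noncomputable def taylorFun (d : Fin 3 → Derivation F R R) (ev : R →ₐ[F] L) (x : R) :
    MvPowerSeries (Fin 3) L :=
  fun α => ((∏ i, (α i).factorial : ℕ) : L)⁻¹ * ev (iterDeriv d α x)

variable {d : Fin 3 → Derivation F R R} {ev : R →ₐ[F] L}

theorem coeff_taylorFun (x : R) (α : Fin 3 →₀ ℕ) :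
    MvPowerSeries.coeff α (taylorFun d ev x) =
      ((∏ i, (α i).factorial : ℕ) : L)⁻¹ * ev (iterDeriv d α x) := rfl

theorem constantCoeff_taylorFun (x : R) :
    MvPowerSeries.constantCoeff (taylorFun d ev x) = ev x := by
  rw [← MvPowerSeries.coeff_zero_eq_constantCoeff_apply, coeff_taylorFun]
  simp

theorem taylorFun_add (x y : R) : taylorFun d ev (x + y) = taylorFun d ev x + taylorFun d ev y := by
  ext α
  simp [coeff_taylorFun, mul_add]

variable [CharZero L]

theorem pderiv_taylorFun (hd : ∀ i j x, d i (d j x) = d j (d i x)) (j : Fin 3) (x : R) :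
    MvPowerSeries.pderiv L j (taylorFun d ev x) = taylorFun d ev (d j x) := by
  ext α
  rw [MvPowerSeries.coeff_pderiv, coeff_taylorFun, coeff_taylorFun, iterDeriv_add_single hd]
  have h : (∏ i, ((α + Finsupp.single j 1 : Fin 3 →₀ ℕ) i).factorial : ℕ) =
      (α j + 1) * ∏ i, (α i).factorial := by
    fin_cases j <;> simp [Fin.prod_univ_three, Nat.factorial_succ, Finsupp.single_apply] <;> ring
  rw [h]
  have h1 : ((∏ i, (α i).factorial : ℕ) : L) ≠ 0 := by
    exact_mod_cast Finset.prod_ne_zero_iff.mpr fun i _ => (α i).factorial_ne_zero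
  have h2 : ((α j : L) + 1) ≠ 0 := by exact_mod_cast (α j).succ_ne_zero
  push_cast at h1 ⊢
  field_simp

/-- Both sides have the same constant term and obey the same Leibniz rule under `∂ⱼ`. In
characteristic zero the coefficient at `β + eⱼ` is recovered from the coefficient at `β` of the
`j`-th derivative, so induction on the multi-index applies. -/
theorem taylorFun_mul (hd : ∀ i j x, d i (d j x) = d j (d i x)) (x y : R) :
    taylorFun d ev (x * y) = taylorFun d ev x * taylorFun d ev y := by
  ext α
  induction α using multiindex_induction generalizing x y with
  | h0 =>
    simp only [MvPowerSeries.coeff_zero_eq_constantCoeff_apply, map_mul, constantCoeff_taylorFun]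
  | hs β j ih =>
    have h1 := MvPowerSeries.coeff_pderiv (i := j) (taylorFun d ev (x * y)) β
    have h2 := MvPowerSeries.coeff_pderiv (i := j) (taylorFun d ev x * taylorFun d ev y) β
    rw [pderiv_taylorFun hd, Derivation.leibniz, smul_eq_mul, smul_eq_mul, taylorFun_add, map_add,
      ih, ih] at h1
    rw [Derivation.leibniz, smul_eq_mul, smul_eq_mul, pderiv_taylorFun hd, pderiv_taylorFun hd,
      map_add] at h2
    have h3 : ((β j : L) + 1) ≠ 0 := by exact_mod_cast (β j).succ_ne_zero
    exact mul_right_cancel₀ h3 (h1.symm.trans h2)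

theorem taylorFun_algebraMap (hd : ∀ i j x, d i (d j x) = d j (d i x)) (c : F) :
    taylorFun d ev (algebraMap F R c) = algebraMap F (MvPowerSeries (Fin 3) L) c := by
  refine MvPowerSeries.pderiv.ext (fun i => ?_) ?_
  · rw [pderiv_taylorFun hd, Derivation.map_algebraMap, MvPowerSeries.algebraMap_apply,
      MvPowerSeries.pderiv_C]
    ext α
    simp [coeff_taylorFun]
  · rw [constantCoeff_taylorFun, MvPowerSeries.algebraMap_apply]
    simp

/-- The Taylor expansion along commuting derivations, as an algebra homomorphism. -/
noncomputable def taylor (hd : ∀ i j x, d i (d j x) = d j (d i x)) (ev : R →ₐ[F] L) :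
    R →ₐ[F] MvPowerSeries (Fin 3) L where
  toFun := taylorFun d ev
  map_one' := by simpa using taylorFun_algebraMap (ev := ev) hd 1
  map_zero' := by simpa using taylorFun_algebraMap (ev := ev) hd 0
  map_add' := taylorFun_add
  map_mul' := taylorFun_mul hd
  commutes' := taylorFun_algebraMap hd

theorem constantCoeff_taylor (hd : ∀ i j x, d i (d j x) = d j (d i x)) (x : R) :
    MvPowerSeries.constantCoeff (taylor hd ev x) = ev x :=
  constantCoeff_taylorFun x

theorem pderiv_taylor (hd : ∀ i j x, d i (d j x) = d j (d i x)) (j : Fin 3) (x : R) :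
    MvPowerSeries.pderiv L j (taylor hd ev x) = taylor hd ev (d j x) :=
  pderiv_taylorFun hd j x

theorem coeff_taylor (hd : ∀ i j x, d i (d j x) = d j (d i x)) (x : R) (α : Fin 3 →₀ ℕ) :
    MvPowerSeries.coeff α (taylor hd ev x) =
      ((∏ i, (α i).factorial : ℕ) : L)⁻¹ * ev (iterDeriv d α x) := rfl

end Taylor

/-! ### The derivations of the ring of differential polynomials. -/

section DiffPolyDerivation

variable {F : Type u} [Field F]

/-- The derivation of `k = F(x, y, p)` that extends the partial derivative number `j`. -/
noncomputable def ratDerivation (j : Fin 3) : Derivation F (RatFun F) (RatFun F) :=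
  fractionDerivation (pderiv j : Derivation F (MvPolynomial (Fin 3) F) (MvPolynomial (Fin 3) F))

theorem algebraMap_denom_ne_zero (f : RatFun F) :
    algebraMap (MvPolynomial (Fin 3) F) (RatFun F) (denom f) ≠ 0 := by
  rw [Ne, FaithfulSMul.algebraMap_eq_zero_iff]
  exact nonZeroDivisors.coe_ne_zero (IsFractionRing.den (MvPolynomial (Fin 3) F) f)

theorem numer_div_denom (f : RatFun F) :
    algebraMap (MvPolynomial (Fin 3) F) (RatFun F) (numer f) /
      algebraMap (MvPolynomial (Fin 3) F) (RatFun F) (denom f) = f :=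
  IsFractionRing.mk'_num_den' _ f

theorem ratDeriv_eq (j : Fin 3) (f : RatFun F) : ratDeriv j f = ratDerivation j f := by
  have h := algebraMap_denom_ne_zero f
  conv_rhs => rw [← numer_div_denom f]
  rw [Derivation.leibniz_div, ratDerivation, fractionDerivation_algebraMap,
    fractionDerivation_algebraMap, ratDeriv]
  simp only [map_sub, map_mul, smul_eq_mul]
  field_simp

/-- Differentiation of the coefficients of a polynomial. -/
noncomputable def coeffMap {k σ : Type*} [Field k] [Algebra F k] (D : Derivation F k k)
    (q : MvPolynomial σ k) : MvPolynomial σ k :=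
  ∑ n ∈ q.support, monomial n (D (coeff n q))

theorem coeff_coeffMap {k σ : Type*} [Field k] [Algebra F k] (D : Derivation F k k)
    (q : MvPolynomial σ k) (m : σ →₀ ℕ) : coeff m (coeffMap D q) = D (coeff m q) := by
  classical
  simp only [coeffMap, coeff_sum, coeff_monomial, Finset.sum_ite_eq', mem_support_iff]
  split_ifs with h
  · rfl
  · rw [not_not.mp h, map_zero]

/-- Differentiation of the coefficients of a polynomial, as a derivation. -/
noncomputable def coeffDerivation {k σ : Type*} [Field k] [Algebra F k] (D : Derivation F k k) :
    Derivation F (MvPolynomial σ k) (MvPolynomial σ k) :=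
  Derivation.mk'
    { toFun := coeffMap D
      map_add' := fun a b => by
        ext m
        simp only [coeff_add, coeff_coeffMap, map_add]
      map_smul' := fun c a => by
        ext m
        simp only [RingHom.id_apply, coeff_smul, coeff_coeffMap, Derivation.map_smul] }
    (fun a b => by
      classical
      ext m
      change coeff m (coeffMap D (a * b)) = coeff m (a * coeffMap D b + b * coeffMap D a)
      rw [mul_comm b, coeff_add, coeff_mul, coeff_mul, coeff_coeffMap, coeff_mul, map_sum,
        ← Finset.sum_add_distrib]
      refine Finset.sum_congr rfl fun x _ => ?_
      rw [Derivation.leibniz, coeff_coeffMap, coeff_coeffMap, smul_eq_mul, smul_eq_mul,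
        mul_comm (coeff x.2 b)])

/-- The derivation number `j` of `k{x̄, ȳ, p̄}`. -/
noncomputable def diffPolyDerivation (j : Fin 3) : Derivation F (DiffPoly F) (DiffPoly F) :=
  coeffDerivation (ratDerivation j) +
    (mkDerivation (RatFun F) (fun v : Fin 3 × (Fin 3 →₀ ℕ) =>
      (X (v.1, v.2 + Finsupp.single j 1) : DiffPoly F))).restrictScalars F

theorem diffPolyDeriv_eq (j : Fin 3) (q : DiffPoly F) :
    diffPolyDeriv j q = diffPolyDerivation j q := by
  simp only [diffPolyDeriv, ratDeriv_eq]
  rfl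

theorem diffPolyDerivation_C (j : Fin 3) (r : RatFun F) :
    diffPolyDerivation j (C r : DiffPoly F) = C (ratDerivation j r) := by
  have h : coeffMap (ratDerivation j) (C r : DiffPoly F) = C (ratDerivation j r) := by
    classical
    ext m
    rw [coeff_coeffMap, coeff_C, coeff_C]
    split_ifs <;> simp
  change coeffMap _ _ + mkDerivation _ _ _ = _
  rw [h, derivation_C, add_zero]

theorem diffPolyDerivation_X (j : Fin 3) (v : Fin 3 × (Fin 3 →₀ ℕ)) :
    diffPolyDerivation j (X v : DiffPoly F) = X (v.1, v.2 + Finsupp.single j 1) := by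
  have h : coeffMap (ratDerivation j) (X v : DiffPoly F) = 0 := by
    classical
    ext m
    rw [coeff_coeffMap, coeff_X]
    split_ifs <;> simp
  change coeffMap _ _ + mkDerivation _ _ _ = _
  rw [h, mkDerivation_X, zero_add]

theorem pderiv_comm {σ R : Type*} [CommRing R] (i j : σ) (P : MvPolynomial σ R) :
    pderiv i (pderiv j P) = pderiv j (pderiv i P) := by
  classical
  have h : ⁅(pderiv i : Derivation R (MvPolynomial σ R) (MvPolynomial σ R)),
      (pderiv j : Derivation R (MvPolynomial σ R) (MvPolynomial σ R))⁆ = 0 := by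
    apply derivation_ext
    intro l
    rw [Derivation.commutator_apply, pderiv_X, pderiv_X, Pi.single_apply, Pi.single_apply]
    split_ifs <;> simp
  have := congrArg (fun D => D P) h
  rwa [Derivation.commutator_apply, Derivation.zero_apply, sub_eq_zero] at this

theorem ratDerivation_comm (i j : Fin 3) (r : RatFun F) :
    ratDerivation i (ratDerivation j r) = ratDerivation j (ratDerivation i r) := by
  refine commute_of_commute_on_fractionRing (A := MvPolynomial (Fin 3) F) _ _ (fun a => ?_) r
  simp only [ratDerivation, fractionDerivation_algebraMap, pderiv_comm i j]

theorem diffPolyDerivation_comm (i j : Fin 3) (q : DiffPoly F) :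
    diffPolyDerivation i (diffPolyDerivation j q) =
      diffPolyDerivation j (diffPolyDerivation i q) := by
  induction q using MvPolynomial.induction_on with
  | C r => simp only [diffPolyDerivation_C, ratDerivation_comm i j]
  | add p q hp hq => simp only [map_add, hp, hq]
  | mul_X q v hq =>
    simp only [Derivation.leibniz, map_add, diffPolyDerivation_X, smul_eq_mul, hq, add_assoc,
      add_comm (Finsupp.single i 1)]
    ring

end DiffPolyDerivation

/-! ### Framed fields. -/

section Frames

variable {F : Type*} [Field F] {N : Type*} [Field N] [Algebra F N]

/-- Three commuting derivations of a field, together with elements `s` on which they are the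
partial derivatives. -/
structure Frame (F : Type*) [Field F] (N : Type*) [Field N] [Algebra F N] where
  /-- The partial derivatives. -/
  d : Fin 3 → Derivation F N N
  comm : ∀ i j x, d i (d j x) = d j (d i x)
  /-- The coordinates. -/
  s : Fin 3 → N
  d_s : ∀ i j, d j (s i) = if i = j then 1 else 0

theorem derivation_aeval {R : Type*} [CommRing R] [Algebra F R] (D : Derivation F R R)
    {σ : Type*} [Fintype σ]
    (t : σ → R) (P : MvPolynomial σ F) :
    D (aeval t P) = ∑ i, aeval t (pderiv i P) * D (t i) := by
  classical
  induction P using MvPolynomial.induction_on with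
  | C a => simp
  | add p q hp hq => simp only [map_add, hp, hq, add_mul, Finset.sum_add_distrib]
  | mul_X q v hq =>
    simp only [map_mul, aeval_X, Derivation.leibniz, smul_eq_mul, hq, map_add, pderiv_X, add_mul,
      Finset.sum_add_distrib, Finset.mul_sum]
    congr 1
    · simp [Pi.single_apply, apply_ite]
    · exact Finset.sum_congr rfl fun i _ => by ring

namespace Frame

variable (Φ : Frame F N)

theorem d_aeval_s (j : Fin 3) (P : MvPolynomial (Fin 3) F) :
    Φ.d j (aeval Φ.s P) = aeval Φ.s (pderiv j P) := by
  rw [derivation_aeval]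
  simp [Φ.d_s]

/-- The partial derivatives of a polynomial relation are relations of smaller degree, so by
induction they are zero polynomials; in characteristic zero the relation is then constant. Thus the
coordinates of any frame are automatically a generic source point. -/
theorem algebraicIndependent_s [CharZero F] : AlgebraicIndependent F Φ.s := by
  rw [algebraicIndependent_iff]
  suffices h : ∀ n, ∀ P : MvPolynomial (Fin 3) F, (∀ m ∈ P.support, m.degree ≤ n) →
      aeval Φ.s P = 0 → P = 0 from
    fun P => h (P.support.sup fun m => m.degree) P
      fun m hm => Finset.le_sup (f := fun m : Fin 3 →₀ ℕ => m.degree) hm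
  have hconst : ∀ P : MvPolynomial (Fin 3) F, (∀ m ∈ P.support, m = 0) →
      aeval Φ.s P = 0 → P = 0 := by
    intro P hm hP
    have h : P = C (coeff 0 P) := by
      ext m
      rw [coeff_C]
      split_ifs with h
      · rw [h]
      · exact notMem_support_iff.mp fun hs => h (hm m hs).symm
    rw [h, aeval_C, FaithfulSMul.algebraMap_eq_zero_iff] at hP
    rw [h, hP, C_0]
  intro n
  induction n with
  | zero => exact fun P hm => hconst P fun m h =>
      (Finsupp.degree_eq_zero_iff m).mp (Nat.le_zero.mp (hm m h))
  | succ n ih =>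
    intro P hdeg hP
    have hpd : ∀ j, pderiv j P = 0 := by
      intro j
      refine ih _ (fun m hm => ?_) (by rw [← Φ.d_aeval_s, hP, map_zero])
      rw [mem_support_iff, coeff_pderiv] at hm
      have := hdeg _ (mem_support_iff.mpr (left_ne_zero_of_mul hm))
      simpa using this
    refine hconst P (fun m hm => ?_) hP
    by_contra h0
    obtain ⟨β, j, rfl⟩ := eq_add_single_of_ne_zero h0
    have h1 : coeff β (pderiv j P) = 0 := by rw [hpd, coeff_zero]
    rw [coeff_pderiv] at h1
    have h2 : ((β j : F) + 1) ≠ 0 := by exact_mod_cast (β j).succ_ne_zero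
    exact mem_support_iff.mp hm ((mul_eq_zero.mp h1).resolve_right h2)

end Frame
end Frames

/-! ### Transformations between two equations: ideals and models. -/

section IsoIdeal

variable {F : Type u} [Field F]

/-- The Lie defining equations of the contact transformations that map `Δ_f` to `Δ_g`. -/
noncomputable def isoEqns (f g : RatFun F) : Set (DiffPoly F) :=
  {tgtJac 1 2 - tgtCoord 2 * tgtJac 0 2,
   (tgtJac 1 0 + srcCoord 2 * tgtJac 1 1) - tgtCoord 2 * (tgtJac 0 0 + srcCoord 2 * tgtJac 0 1),
   cartanTgt f 1 - tgtCoord 2 * cartanTgt f 0,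
   atTarget (denom g) * cartanTgt f 2 - atTarget (numer g) * cartanTgt f 0}

/-- The differential ideal of the transformations in `Φᵢ` that map `E_f` to `E_g`. -/
noncomputable def isoIdeal (f g : RatFun F) (i : GroupoidIndex) : Ideal (DiffPoly F) :=
  saturation (diffIdeal (isoEqns f g ∪ prolongedEqns i srcCoord tgtCoord tgtJac)).radical
    (inequation g)

/-- The number of arbitrary constants in the transformations in `Φᵢ` that map `E_f` to `E_g`. -/
noncomputable def isoDim (f g : RatFun F) (i : GroupoidIndex) : Cardinal.{u} :=
  Algebra.trdeg (RatFun F) (DiffPoly F ⧸ isoIdeal f g i)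

end IsoIdeal

theorem isTranscendenceBasis_coordinates {F : Type*} [Field F] :
    IsTranscendenceBasis F fun j => algebraMap (MvPolynomial (Fin 3) F) (RatFun F) (X j) :=
  have : Algebra.IsAlgebraic (MvPolynomial (Fin 3) F) (RatFun F) :=
    IsLocalization.isAlgebraic _ (nonZeroDivisors (MvPolynomial (Fin 3) F))
  (IsTranscendenceBasis.mvPolynomial (Fin 3) F).algebraMap_comp

namespace Frame

variable {F : Type*} [Field F] [CharZero F] {N : Type*} [Field N] [Algebra F N] (Φ : Frame F N)

/-- The value of a rational function at the coordinates of a frame. -/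
noncomputable def coe : RatFun F →ₐ[F] N :=
  IsFractionRing.liftAlgHom (algebraicIndependent_iff_injective_aeval.mp Φ.algebraicIndependent_s)

theorem coe_algebraMap (P : MvPolynomial (Fin 3) F) :
    Φ.coe (algebraMap _ (RatFun F) P) = aeval Φ.s P := by
  simp [coe]

theorem coe_eq (f : RatFun F) : Φ.coe f = aeval Φ.s (numer f) / aeval Φ.s (denom f) := by
  conv_lhs => rw [← numer_div_denom f]
  rw [map_div₀, coe_algebraMap, coe_algebraMap]

theorem d_coe (j : Fin 3) (f : RatFun F) : Φ.d j (Φ.coe f) = Φ.coe (ratDerivation j f) := by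
  refine (derivation_eq_of_eq_on_fractionRing (A := MvPolynomial (Fin 3) F) (F := F)
    Φ.coe.toRingHom (ratDerivation j) (Φ.d j) (fun P => ?_) f).symm
  change Φ.coe _ = Φ.d j (Φ.coe _)
  rw [ratDerivation, fractionDerivation_algebraMap, coe_algebraMap, coe_algebraMap, d_aeval_s]

theorem algHom_eq_coe (g : RatFun F →ₐ[F] N)
    (hg : ∀ j, g (algebraMap (MvPolynomial (Fin 3) F) (RatFun F) (X j)) = Φ.s j) : g = Φ.coe := by
  have h : (g : RatFun F →+* N) = (Φ.coe : RatFun F →+* N) := by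
    apply IsLocalization.ringHom_ext (nonZeroDivisors (MvPolynomial (Fin 3) F))
    apply MvPolynomial.ringHom_ext
    · intro a
      change g (algebraMap _ _ (algebraMap F _ a)) = Φ.coe (algebraMap _ _ (algebraMap F _ a))
      rw [← IsScalarTower.algebraMap_apply, AlgHom.commutes, AlgHom.commutes]
    · intro j
      change g (algebraMap _ _ (X j)) = Φ.coe (algebraMap _ _ (X j))
      rw [hg, coe_algebraMap, aeval_X]
  exact AlgHom.ext fun x => congrArg (fun φ => φ x) h

/-- The value of the Cartan field `D_f` at an element. -/
noncomputable def cartan (f : RatFun F) (a : N) : N :=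
  Φ.d 0 a + Φ.s 2 * Φ.d 1 a + Φ.coe f * Φ.d 2 a

/-- The derivatives of all orders of `t`. -/
def jets (t : Fin 3 → N) : Set N :=
  Set.range fun v : Fin 3 × (Fin 3 →₀ ℕ) => iterDeriv Φ.d v.2 (t v.1)

/-- The transcendence degree of the field generated by the jets of `t`. -/
noncomputable def totalDim (t : Fin 3 → N) : Cardinal :=
  algRank F (Set.range Φ.s ∪ Φ.jets t)

/-- The tuple `t` of elements of a framed field is a transformation in `Φᵢ` with source `s` that
maps `E_f` to `E_g`. -/
structure IsModel (i : GroupoidIndex) (f g : RatFun F) (t : Fin 3 → N) : Prop where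
  det_ne : Matrix.det (Matrix.of fun u j : Fin 3 => Φ.d j (t u)) ≠ 0
  denom_ne : aeval t (denom g) ≠ 0
  eqns : ∀ e ∈ prolongedEqns i Φ.s t (fun u j => Φ.d j (t u)), e = 0
  ode : aeval t (denom g) * Φ.cartan f (t 2) = aeval t (numer g) * Φ.cartan f (t 0)

theorem IsModel.contact {Φ : Frame F N} {i : GroupoidIndex} {f g : RatFun F} {t : Fin 3 → N}
    (h : Φ.IsModel i f g t) :
    Φ.d 2 (t 0) = 0 ∧ Φ.d 2 (t 1) = 0 ∧
      t 2 * (Φ.d 0 (t 0) + Φ.s 2 * Φ.d 1 (t 0)) = Φ.d 0 (t 1) + Φ.s 2 * Φ.d 1 (t 1) := by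
  refine ⟨h.eqns _ ?_, h.eqns _ ?_, sub_eq_zero.mp (h.eqns _ ?_)⟩ <;> simp [prolongedEqns]

/-- Evaluation of differential polynomials. -/
noncomputable def evalDiff (t : Fin 3 → N) : DiffPoly F →+* N :=
  eval₂Hom Φ.coe.toRingHom fun v => iterDeriv Φ.d v.2 (t v.1)

variable (t : Fin 3 → N)

@[simp]
theorem evalDiff_C (r : RatFun F) : Φ.evalDiff t (C r) = Φ.coe r := eval₂Hom_C _ _ _

@[simp]
theorem evalDiff_X (v : Fin 3 × (Fin 3 →₀ ℕ)) :
    Φ.evalDiff t (X v) = iterDeriv Φ.d v.2 (t v.1) := eval₂Hom_X' _ _ _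

theorem evalDiff_derivation (j : Fin 3) (q : DiffPoly F) :
    Φ.evalDiff t (diffPolyDerivation j q) = Φ.d j (Φ.evalDiff t q) := by
  induction q using MvPolynomial.induction_on with
  | C r => rw [diffPolyDerivation_C, evalDiff_C, evalDiff_C, d_coe]
  | add p q hp hq => simp only [map_add, hp, hq]
  | mul_X q v hq =>
    simp only [Derivation.leibniz, smul_eq_mul, map_add, map_mul, diffPolyDerivation_X, hq,
      evalDiff_X, iterDeriv_add_single' Φ.comm]

@[simp]
theorem evalDiff_srcCoord (j : Fin 3) : Φ.evalDiff t (srcCoord j) = Φ.s j := by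
  rw [srcCoord, evalDiff_C, coe_algebraMap, aeval_X]

@[simp]
theorem evalDiff_tgtCoord (v : Fin 3) : Φ.evalDiff t (tgtCoord v) = t v := by
  rw [tgtCoord, evalDiff_X, iterDeriv_zero]

@[simp]
theorem evalDiff_tgtJac (v j : Fin 3) : Φ.evalDiff t (tgtJac v j) = Φ.d j (t v) := by
  rw [tgtJac, diffPolyDeriv_eq, evalDiff_derivation, evalDiff_tgtCoord]

end Frame

section HomEqns

variable {F : Type*} [Field F] {N : Type*} [CommRing N] [Algebra F N]

theorem map_atTarget (T : DiffPoly F →+* N) (t : Fin 3 → N) (hF : ∀ c : F, T (C (algebraMap F _ c)) = algebraMap F N c)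
    (ht : ∀ v, T (tgtCoord v) = t v)
    (P : MvPolynomial (Fin 3) F) : T (atTarget P) = aeval t P := by
  induction P using MvPolynomial.induction_on with
  | C a =>
    rw [atTarget, aeval_C, aeval_C, ← hF]
    rfl
  | add p q hp hq => rw [atTarget, map_add, map_add, map_add, ← hp, ← hq]; rfl
  | mul_X q v hq => rw [atTarget, map_mul, map_mul, map_mul, ← hq, aeval_X, aeval_X, ht]; rfl

theorem image_prolongedEqns {A B : Type*} [CommRing A] [CommRing B] (T : A →+* B)
    (i : GroupoidIndex) (b t : Fin 3 → A) (J : Fin 3 → Fin 3 → A) :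
    T '' prolongedEqns i b t J =
      prolongedEqns i (fun v => T (b v)) (fun v => T (t v)) (fun v j => T (J v j)) := by
  cases i <;> simp [prolongedEqns, planeEqns, Set.image_insert_eq]

end HomEqns

namespace Frame

variable {F : Type u} [Field F] [CharZero F] {N : Type u} [Field N] [Algebra F N] (Φ : Frame F N)

@[simp]
theorem evalDiff_atTarget (t : Fin 3 → N) (P : MvPolynomial (Fin 3) F) :
    Φ.evalDiff t (atTarget P) = aeval t P :=
  map_atTarget _ _ (fun c => by rw [evalDiff_C, AlgHom.commutes]) (Φ.evalDiff_tgtCoord t) P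

@[simp]
theorem evalDiff_cartanTgt (t : Fin 3 → N) (f : RatFun F) (v : Fin 3) :
    Φ.evalDiff t (cartanTgt f v) = Φ.cartan f (t v) := by
  simp [cartanTgt, cartan]

theorem evalDiff_inequation (t : Fin 3 → N) (g : RatFun F) :
    Φ.evalDiff t (inequation g) =
      Matrix.det (Matrix.of fun u j : Fin 3 => Φ.d j (t u)) * aeval t (denom g) := by
  rw [inequation, map_mul, evalDiff_atTarget, RingHom.map_det]
  congr 2
  ext v j
  simp

variable {Φ} {t : Fin 3 → N} {i : GroupoidIndex} {f g : RatFun F}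

/-- Evaluation at a model commutes with the derivations and lands in a field, so its kernel is a
prime differential ideal. It contains the equations and omits the inequation, hence it absorbs both
the radical and the saturation. -/
theorem IsModel.isoIdeal_le_ker (h : Φ.IsModel i f g t) :
    isoIdeal f g i ≤ RingHom.ker (Φ.evalDiff t) := by
  have hprime : (RingHom.ker (Φ.evalDiff t)).IsPrime := RingHom.ker_isPrime _
  have h1 : diffIdeal (isoEqns f g ∪ prolongedEqns i srcCoord tgtCoord tgtJac) ≤
      RingHom.ker (Φ.evalDiff t) := by
    refine sInf_le ⟨?_, fun j q hq => ?_⟩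
    · obtain ⟨h0, h1, h2⟩ := h.contact
      rintro e (he | he)
      · have ho := h.ode
        simp only [isoEqns, Set.mem_insert_iff, Set.mem_singleton_iff] at he
        rw [SetLike.mem_coe, RingHom.mem_ker]
        -- For prolonged point transformations the first three equations follow from the groupoid
        -- equations, which is why `IsModel` keeps only the last one as `ode`.
        rcases he with rfl | rfl | rfl | rfl
        · simp [h0, h1]
        · simp [h2]
        · simp [cartan, h0, h1, h2]
        · simp [ho]
      · have := Set.mem_image_of_mem (Φ.evalDiff t) he
        rw [image_prolongedEqns] at this
        simp only [evalDiff_srcCoord, evalDiff_tgtCoord, evalDiff_tgtJac] at this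
        exact h.eqns _ this
    · rw [RingHom.mem_ker] at hq ⊢
      rw [diffPolyDeriv_eq, evalDiff_derivation, hq, map_zero]
  rintro q ⟨n, hn⟩
  have h2 := (hprime.isRadical.radical_le_iff.mpr h1) hn
  refine (hprime.mem_or_mem h2).resolve_left fun h3 => ?_
  have h4 := hprime.mem_of_pow_mem n h3
  rw [RingHom.mem_ker, evalDiff_inequation] at h4
  exact mul_ne_zero h.det_ne h.denom_ne h4

/-- The `3` is the transcendence degree of `F(x, y, p)`. Counting over `F` gives a quantity in which
source and target play symmetric roles, unlike the degree over `F(x, y, p)`, whose embedding depends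
on the source. -/
theorem totalDim_eq (Φ : Frame F N) (t : Fin 3 → N) :
    letI := Φ.coe.toRingHom.toAlgebra
    Φ.totalDim t = 3 + algRank (RatFun F) (Φ.jets t) := by
  let := Φ.coe.toRingHom.toAlgebra
  have : IsScalarTower F (RatFun F) N := IsScalarTower.of_algebraMap_eq fun c =>
    (Φ.coe.commutes c).symm
  have := algRank_union_range (F := F) (N := N) isTranscendenceBasis_coordinates (Φ.jets t)
  have h : Set.range (algebraMap (RatFun F) N ∘
      fun j => algebraMap (MvPolynomial (Fin 3) F) (RatFun F) (X j)) = Set.range Φ.s := by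
    congr 1
    ext j
    change Φ.coe _ = _
    rw [coe_algebraMap, aeval_X]
  rw [h] at this
  exact_mod_cast this

/-- A transcendence basis chosen among the jets lifts to classes of differential variables in the
residue ring, and these are independent because their images are. -/
theorem IsModel.totalDim_le (h : Φ.IsModel i f g t) : Φ.totalDim t ≤ 3 + isoDim f g i := by
  let := Φ.coe.toRingHom.toAlgebra
  rw [totalDim_eq]
  gcongr
  obtain ⟨B, hB, hind, -, hc⟩ :=
    exists_subset_algebraicIndependent_of_algRank (k := RatFun F) (Φ.jets t)
  rw [← hc]
  choose v hv using fun b : B => hB b.2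
  let θ : (DiffPoly F ⧸ isoIdeal f g i) →ₐ[RatFun F] N :=
    Ideal.Quotient.liftₐ _ { Φ.evalDiff t with commutes' := Φ.evalDiff_C t }
      fun a ha => h.isoIdeal_le_ker ha
  have hx : AlgebraicIndependent (RatFun F)
      (fun b : B => Ideal.Quotient.mk (isoIdeal f g i) (X (v b))) := by
    refine AlgebraicIndependent.of_comp θ ?_
    have : (θ ∘ fun b : B => Ideal.Quotient.mk (isoIdeal f g i) (X (v b))) =
        ((↑) : B → N) := by
      ext b
      exact (Φ.evalDiff_X t (v b)).trans (hv b)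
    rwa [this]
  exact hx.cardinalMk_le_trdeg

end Frame

/-! ### Frames of formal Laurent series. -/

section PowerSeries

theorem powerSeries_pderiv_comm {σ L : Type*} [CommRing L] (i j : σ) (x : MvPowerSeries σ L) :
    MvPowerSeries.pderiv L i (MvPowerSeries.pderiv L j x) =
      MvPowerSeries.pderiv L j (MvPowerSeries.pderiv L i x) := by
  classical
  ext n
  simp only [MvPowerSeries.coeff_pderiv, add_right_comm n (Finsupp.single i 1), Finsupp.add_apply,
    Finsupp.single_apply]
  by_cases h : i = j
  · subst h; rfl
  · simp only [h, Ne.symm h, if_false, add_zero]; ring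

variable (F : Type*) [Field F] (L : Type*) [Field L] [Algebra F L]

instance : IsDomain (MvPowerSeries (Fin 3) L) := NoZeroDivisors.to_isDomain _

/-- The field of formal Laurent series in three variables. -/
abbrev PowerFrac : Type _ := FractionRing (MvPowerSeries (Fin 3) L)

/-- The partial derivatives of formal Laurent series. -/
noncomputable def powerDeriv (j : Fin 3) : Derivation F (PowerFrac L) (PowerFrac L) :=
  fractionDerivation ((MvPowerSeries.pderiv L j).restrictScalars F)

theorem powerDeriv_comm (i j : Fin 3) (x : PowerFrac L) :
    powerDeriv F L i (powerDeriv F L j x) = powerDeriv F L j (powerDeriv F L i x) := by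
  refine commute_of_commute_on_fractionRing (A := MvPowerSeries (Fin 3) L) _ _ (fun a => ?_) x
  simp only [powerDeriv, fractionDerivation_algebraMap, Derivation.restrictScalars_apply,
    powerSeries_pderiv_comm i j]

variable {F L}
variable [CharZero L] {R : Type*} [CommRing R] [Algebra F R] {d : Fin 3 → Derivation F R R}

/-- The Taylor expansion, as a formal Laurent series. -/
noncomputable def taylorFrac (hd : ∀ i j x, d i (d j x) = d j (d i x)) (ev : R →ₐ[F] L) :
    R →ₐ[F] PowerFrac L :=
  (IsScalarTower.toAlgHom F (MvPowerSeries (Fin 3) L) (PowerFrac L)).comp (taylor hd ev)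

theorem powerDeriv_taylorFrac (hd : ∀ i j x, d i (d j x) = d j (d i x)) (ev : R →ₐ[F] L)
    (j : Fin 3) (x : R) :
    powerDeriv F L j (taylorFrac hd ev x) = taylorFrac hd ev (d j x) := by
  refine (fractionDerivation_algebraMap ((MvPowerSeries.pderiv L j).restrictScalars F)
    (taylor hd ev x)).trans ?_
  rw [Derivation.restrictScalars_apply, pderiv_taylor]
  rfl

/-- The constant term of a Taylor series is the value at the point; thus inequations and algebraic
independence at the point persist for the series. -/
theorem ev_eq_zero_of_taylorFrac_eq_zero (hd : ∀ i j x, d i (d j x) = d j (d i x))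
    (ev : R →ₐ[F] L) {x : R} (h : taylorFrac hd ev x = 0) : ev x = 0 := by
  have h1 : taylor hd ev x = 0 := (FaithfulSMul.algebraMap_eq_zero_iff _ (PowerFrac L)).mp h
  rw [← constantCoeff_taylor hd, h1, map_zero]

/-- The frame of formal Laurent series given by the Taylor expansions of elements `s` on which
the given derivations are the partial derivatives. -/
noncomputable def taylorFrame (hd : ∀ i j x, d i (d j x) = d j (d i x)) (ev : R →ₐ[F] L)
    (s : Fin 3 → R) (hs : ∀ i j, d j (s i) = if i = j then 1 else 0) : Frame F (PowerFrac L) where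
  d := powerDeriv F L
  comm := powerDeriv_comm F L
  s := fun i => taylorFrac hd ev (s i)
  d_s := fun i j => by
    rw [powerDeriv_taylorFrac, hs]
    split_ifs <;> simp

end PowerSeries

/-! ### Models from points of the differential ideal. -/

section ExistsModel

section

variable {F : Type u} [Field F]

theorem diffIdeal_closed (E : Set (DiffPoly F)) (j : Fin 3) :
    ∀ q ∈ diffIdeal E, diffPolyDerivation j q ∈ diffIdeal E := by
  intro q hq
  rw [diffIdeal, Submodule.mem_sInf] at hq ⊢
  intro I hI
  rw [← diffPolyDeriv_eq]
  exact hI.2 j q (hq I hI)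

theorem subset_diffIdeal (E : Set (DiffPoly F)) : E ⊆ diffIdeal E := by
  intro q hq
  rw [SetLike.mem_coe, diffIdeal, Submodule.mem_sInf]
  exact fun I hI => hI.1 hq

end

variable {F : Type u} [Field F] [CharZero F] {N : Type u} [Field N] [Algebra F N]
  {i : GroupoidIndex} {f g : RatFun F}

/-- A homomorphism compatible with the derivations is determined by the source coordinates and the
three indeterminates. -/
theorem Frame.eq_evalDiff (Φ : Frame F N) (t : Fin 3 → N) (Θ : DiffPoly F →ₐ[F] N)
    (hd : ∀ j q, Φ.d j (Θ q) = Θ (diffPolyDerivation j q)) (hs : ∀ j, Θ (srcCoord j) = Φ.s j)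
    (ht : ∀ v, Θ (tgtCoord v) = t v) : (Θ : DiffPoly F →+* N) = Φ.evalDiff t := by
  have hC : ∀ r, Θ (C r) = Φ.coe r := by
    have := Φ.algHom_eq_coe (Θ.comp (IsScalarTower.toAlgHom F (RatFun F) (DiffPoly F))) hs
    exact fun r => congrArg (fun φ => φ r) this
  apply MvPolynomial.ringHom_ext
  · intro r
    rw [evalDiff_C, ← hC]
    rfl
  · rintro ⟨v, α⟩
    rw [evalDiff_X]
    change Θ _ = _
    induction α using multiindex_induction with
    | h0 => rw [iterDeriv_zero, ← ht]; rfl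
    | hs β j ih => rw [iterDeriv_add_single' Φ.comm, ← ih, hd, diffPolyDerivation_X]

theorem Frame.isModel_of_evalDiff (Φ : Frame F N) (t : Fin 3 → N)
    (h0 : ∀ q ∈ isoEqns f g ∪ prolongedEqns i srcCoord tgtCoord tgtJac, Φ.evalDiff t q = 0)
    (h1 : Φ.evalDiff t (inequation g) ≠ 0) : Φ.IsModel i f g t where
  det_ne := by
    rw [evalDiff_inequation] at h1
    exact left_ne_zero_of_mul h1
  denom_ne := by
    rw [evalDiff_inequation] at h1
    exact right_ne_zero_of_mul h1
  eqns := by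
    have h : prolongedEqns i Φ.s t (fun u j => Φ.d j (t u)) =
        Φ.evalDiff t '' prolongedEqns i srcCoord tgtCoord tgtJac := by
      rw [image_prolongedEqns]
      simp
    rw [h]
    rintro _ ⟨q, hq, rfl⟩
    exact h0 q (Or.inr hq)
  ode := by
    have := h0 (atTarget (denom g) * cartanTgt f 2 - atTarget (numer g) * cartanTgt f 0)
      (Or.inl (by simp [isoEqns]))
    simpa [sub_eq_zero] using this

theorem Frame.evalDiff_mem (Φ : Frame F N) (t : Fin 3 → N) (q : DiffPoly F) :
    let := Φ.coe.toRingHom.toAlgebra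
    Φ.evalDiff t q ∈ algClosure (RatFun F) (Φ.jets t) := by
  let := Φ.coe.toRingHom.toAlgebra
  refine adjoin_subset_algClosure _ ?_
  rw [SetLike.mem_coe]
  induction q using MvPolynomial.induction_on with
  | C r =>
    rw [Frame.evalDiff_C]
    exact (IntermediateField.adjoin (RatFun F) (Φ.jets t)).algebraMap_mem r
  | add p q hp hq => rw [map_add]; exact add_mem hp hq
  | mul_X q v hq =>
    rw [map_mul, Frame.evalDiff_X]
    exact mul_mem hq (IntermediateField.subset_adjoin _ _ ⟨v, rfl⟩)

/-- The `y` are arbitrary differential polynomials, not single jets; their values still lie in the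
field generated by the jets, by `Frame.evalDiff_mem`. -/
theorem Frame.le_totalDim (Φ : Frame F N) (t : Fin 3 → N) {ι : Type u} (y : ι → DiffPoly F)
    (hy : ∀ p : MvPolynomial ι (RatFun F), Φ.evalDiff t (aeval y p) = 0 → p = 0) :
    3 + #ι ≤ Φ.totalDim t := by
  let := Φ.coe.toRingHom.toAlgebra
  rw [Φ.totalDim_eq]
  gcongr
  have hind : AlgebraicIndependent (RatFun F) fun a => Φ.evalDiff t (y a) := by
    rw [algebraicIndependent_iff]
    intro p hp
    refine hy p ?_
    rw [← hp]
    clear hp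
    induction p using MvPolynomial.induction_on with
    | C r =>
      rw [aeval_C, aeval_C]
      exact Φ.evalDiff_C t r
    | add p q hp hq => simp only [map_add, hp, hq]
    | mul_X q v hq => simp only [map_mul, hq, aeval_X]
  rw [← Cardinal.mk_range_eq _ hind.injective]
  refine (cardinalMk_le_algRank hind.coe_range le_rfl).trans
    (algRank_le_of_subset_algClosure ?_)
  rintro _ ⟨a, rfl⟩
  exact Φ.evalDiff_mem t (y a)

/-- A point of the differential ideal prescribes all derivatives consistently, so its Taylor series
is a formal solution; no convergence or integrability argument is needed. -/
theorem exists_isModel_of_point {E : Type u} [Field E] [CharZero E] [Algebra F E]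
    (ev : DiffPoly F →ₐ[F] E)
    (h0 : ∀ q ∈ diffIdeal (isoEqns f g ∪ prolongedEqns i srcCoord tgtCoord tgtJac), ev q = 0)
    (h1 : ev (inequation g) ≠ 0) {ι : Type u} (y : ι → DiffPoly F)
    (hy : ∀ p : MvPolynomial ι (RatFun F), ev (aeval y p) = 0 → p = 0) :
    ∃ (Φ : Frame F (PowerFrac E)) (t : Fin 3 → PowerFrac E),
      Φ.IsModel i f g t ∧ 3 + #ι ≤ Φ.totalDim t := by
  let Φ := taylorFrame diffPolyDerivation_comm ev srcCoord fun a j => by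
    rw [srcCoord, diffPolyDerivation_C, ratDerivation, fractionDerivation_algebraMap, pderiv_X,
      Pi.single_apply]
    split_ifs <;> simp
  let Θ : DiffPoly F →ₐ[F] PowerFrac E := taylorFrac diffPolyDerivation_comm ev
  let t : Fin 3 → PowerFrac E := fun v => Θ (tgtCoord v)
  have hΘ : (Θ : DiffPoly F →+* _) = Φ.evalDiff t :=
    Φ.eq_evalDiff t Θ (fun j q => powerDeriv_taylorFrac _ _ _ _) (fun _ => rfl) fun _ => rfl
  have hne : ∀ q, Φ.evalDiff t q = 0 → ev q = 0 := fun q hq =>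
    ev_eq_zero_of_taylorFrac_eq_zero diffPolyDerivation_comm ev
      ((congrArg (fun φ => φ q) hΘ).trans hq)
  refine ⟨Φ, t, Φ.isModel_of_evalDiff t (fun q hq => ?_) (fun h => h1 (hne _ h)),
    Φ.le_totalDim t y fun p hp => hy p (hne _ hp)⟩
  rw [← hΘ]
  -- Every coefficient is, up to a factorial, the value of an iterated derivative of an equation,
  -- which lies in the differential ideal.
  have : taylor diffPolyDerivation_comm ev q = 0 := by
    ext α
    rw [coeff_taylor, h0, mul_zero, map_zero]
    exact iterDeriv_mem_of_closed diffPolyDerivation_comm (diffIdeal_closed _)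
      (subset_diffIdeal _ hq) α
  change algebraMap _ _ (taylor diffPolyDerivation_comm ev q) = 0
  rw [this, map_zero]

/-- The residue ring need not be a domain, so a prime over the ideal is chosen at which the given
family stays independent and the inequation stays nonzero; the residue field of that prime is the
required point. -/
theorem exists_isModel_totalDim_ge {ι : Type u} {x : ι → DiffPoly F ⧸ isoIdeal f g i}
    (hx : AlgebraicIndependent (RatFun F) x) :
    ∃ (N : Type u) (_ : Field N) (_ : Algebra F N) (Φ : Frame F N) (t : Fin 3 → N),
      Φ.IsModel i f g t ∧ 3 + #ι ≤ Φ.totalDim t := by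
  choose y hy using fun a => Ideal.Quotient.mk_surjective (x a)
  have hxy : ∀ p : MvPolynomial ι (RatFun F),
      Ideal.Quotient.mk (isoIdeal f g i) (aeval y p) = aeval x p := by
    intro p
    have : x = fun a => Ideal.Quotient.mkₐ (RatFun F) (isoIdeal f g i) (y a) :=
      funext fun a => (hy a).symm
    rw [this, ← MvPolynomial.comp_aeval_apply]
    rfl
  -- Such a prime exists: if `p(y) · hⁿ` were in the ideal with `p ≠ 0` and `h` the inequation,
  -- saturation would put `p(y)` in it, against independence.
  obtain ⟨P, hP, hle, hdis⟩ := Ideal.exists_le_prime_disjoint (isoIdeal f g i)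
    ((nonZeroDivisors (MvPolynomial ι (RatFun F))).map
      (aeval y : _ →ₐ[RatFun F] DiffPoly F) ⊔ Submonoid.powers (inequation g)) (by
    rw [Set.disjoint_left]
    rintro q hq hq'
    obtain ⟨_, ⟨p, hp, rfl⟩, _, ⟨n, rfl⟩, rfl⟩ := Submonoid.mem_sup.mp hq'
    obtain ⟨m, hm⟩ := hq
    have h1 : (aeval y p : DiffPoly F) ∈ isoIdeal f g i := by
      refine ⟨m + n, ?_⟩
      rwa [pow_add, mul_assoc, mul_comm (inequation g ^ n)]
    rw [← Ideal.Quotient.eq_zero_iff_mem, hxy] at h1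
    exact nonZeroDivisors.ne_zero hp (hx.eq_zero_of_aeval_eq_zero p h1))
  have hPprime := hP
  have hchar : CharZero (FractionRing (DiffPoly F ⧸ P)) :=
    charZero_of_injective_algebraMap (algebraMap F _).injective
  let ev : DiffPoly F →ₐ[F] FractionRing (DiffPoly F ⧸ P) :=
    (IsScalarTower.toAlgHom F (DiffPoly F ⧸ P) (FractionRing (DiffPoly F ⧸ P))).comp
      (Ideal.Quotient.mkₐ F P)
  have hev : ∀ q, ev q = 0 ↔ q ∈ P := fun q =>
    (map_eq_zero_iff _ (IsFractionRing.injective (DiffPoly F ⧸ P)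
      (FractionRing (DiffPoly F ⧸ P)))).trans Ideal.Quotient.eq_zero_iff_mem
  obtain ⟨Φ, t, h⟩ := exists_isModel_of_point (f := f) (g := g) (i := i) ev
    (fun q hq => (hev q).mpr (hle ⟨0, by
      rw [pow_zero, one_mul]
      exact Ideal.le_radical hq⟩))
    (fun h => Set.disjoint_left.mp hdis ((hev _).mp h)
      (Submonoid.mem_sup_right (Submonoid.mem_powers _))) y
    (fun p hp => by
      by_contra hp0
      refine Set.disjoint_left.mp hdis ((hev _).mp hp) (Submonoid.mem_sup_left ?_)
      exact ⟨p, mem_nonZeroDivisors_of_ne_zero hp0, rfl⟩)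
  exact ⟨_, _, _, Φ, t, h⟩

end ExistsModel

/-! ### Change of coordinates in a frame: inverses and quotients of models. -/

section ClosedSubfields

theorem derivation_mem_adjoin {F K N : Type*} [Field F] [Field K] [Field N] [Algebra F N]
    [Algebra K N] (D : Derivation F N N) (X : Set N)
    (hK : ∀ r : K, D (algebraMap K N r) ∈ IntermediateField.adjoin K X)
    (hX : ∀ x ∈ X, D x ∈ IntermediateField.adjoin K X) {x : N}
    (hx : x ∈ IntermediateField.adjoin K X) : D x ∈ IntermediateField.adjoin K X := by
  induction hx using IntermediateField.adjoin_induction with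
  | mem x hx => exact hX x hx
  | algebraMap r => exact hK r
  | add x y _ _ hx hy => rw [map_add]; exact add_mem hx hy
  | mul x y hx' hy' hx hy =>
    rw [Derivation.leibniz, smul_eq_mul, smul_eq_mul]
    exact add_mem (mul_mem hx' hy) (mul_mem hy' hx)
  | inv x hx' hx =>
    rw [Derivation.leibniz_inv, smul_eq_mul]
    exact mul_mem (neg_mem (pow_mem (inv_mem hx') 2)) hx

theorem inv_entry_mem {K N : Type*} [Field K] [Field N] [Algebra K N] (E : IntermediateField K N)
    {n : Type*} [Fintype n] [DecidableEq n] (A : Matrix n n N) (h : ∀ i j, A i j ∈ E) (i j : n) :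
    A⁻¹ i j ∈ E := by
  let B : Matrix n n E := Matrix.of fun i j => ⟨A i j, h i j⟩
  have hA : A = B.map (algebraMap E N) := rfl
  have : A⁻¹ = B⁻¹.map (algebraMap E N) := by
    rw [hA, Matrix.inv_def, Matrix.inv_def, ← RingHom.mapMatrix_apply, ← RingHom.map_det,
      ← RingHom.map_adjugate]
    ext i j
    simp
  rw [this]
  exact (B⁻¹ i j).2

end ClosedSubfields

namespace Frame

variable {F : Type*} [Field F] {N : Type*} [Field N] [Algebra F N] (Φ : Frame F N)

/-- The Jacobian matrix of a tuple of elements. -/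
def jac (σ : Fin 3 → N) : Matrix (Fin 3) (Fin 3) N := Matrix.of fun u j => Φ.d j (σ u)

/-- The partial derivatives with respect to new coordinates. -/
noncomputable def newDeriv (σ : Fin 3 → N) (j : Fin 3) : Derivation F N N :=
  ∑ l, (Φ.jac σ)⁻¹ l j • Φ.d l

theorem newDeriv_apply (σ : Fin 3 → N) (j : Fin 3) (x : N) :
    Φ.newDeriv σ j x = ∑ l, (Φ.jac σ)⁻¹ l j * Φ.d l x := by
  simp [newDeriv, Fin.sum_univ_three]

variable {σ : Fin 3 → N}

theorem newDeriv_coord (h : (Φ.jac σ).det ≠ 0) (i j : Fin 3) :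
    Φ.newDeriv σ j (σ i) = if i = j then 1 else 0 := by
  have := congrFun (congrFun (Matrix.mul_nonsing_inv (Φ.jac σ) (Ne.isUnit h)) i) j
  rw [Matrix.mul_apply, Matrix.one_apply] at this
  rw [newDeriv_apply, ← this]
  exact Finset.sum_congr rfl fun l _ => mul_comm _ _

theorem d_eq_sum_newDeriv (h : (Φ.jac σ).det ≠ 0) (l : Fin 3) (x : N) :
    Φ.d l x = ∑ j, Φ.d l (σ j) * Φ.newDeriv σ j x := by
  have key : ∀ m, ∑ j, (Φ.jac σ)⁻¹ m j * Φ.d l (σ j) = if m = l then 1 else 0 := fun m => by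
    have := congrFun (congrFun (Matrix.nonsing_inv_mul (Φ.jac σ) (Ne.isUnit h)) m) l
    rwa [Matrix.mul_apply, Matrix.one_apply] at this
  calc Φ.d l x = ∑ m, (if m = l then 1 else 0) * Φ.d m x := by simp
    _ = ∑ m, ∑ j, (Φ.jac σ)⁻¹ m j * Φ.d l (σ j) * Φ.d m x := by
      simp only [← key, Finset.sum_mul]
    _ = _ := by
      rw [Finset.sum_comm]
      refine Finset.sum_congr rfl fun j _ => ?_
      rw [newDeriv_apply, Finset.mul_sum]
      exact Finset.sum_congr rfl fun m _ => by ring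

/-- The second order terms of the commutator cancel, so it is a combination of the old derivations.
It kills the coordinates `σ`, and the invertible Jacobian then forces its coefficients to vanish.
The first point is essential, since derivations of `N` need not be determined by their values on
`σ`. -/
theorem newDeriv_comm (h : (Φ.jac σ).det ≠ 0) (i j : Fin 3) (x : N) :
    Φ.newDeriv σ i (Φ.newDeriv σ j x) = Φ.newDeriv σ j (Φ.newDeriv σ i x) := by
  have expand : ∀ i j x, Φ.newDeriv σ i (Φ.newDeriv σ j x) =
      ∑ l, Φ.newDeriv σ i ((Φ.jac σ)⁻¹ l j) * Φ.d l x +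
        ∑ l, ∑ m, (Φ.jac σ)⁻¹ l j * (Φ.jac σ)⁻¹ m i * Φ.d m (Φ.d l x) := by
    intro i j x
    rw [Φ.newDeriv_apply σ j, map_sum, ← Finset.sum_add_distrib]
    refine Finset.sum_congr rfl fun l _ => ?_
    rw [Derivation.leibniz, smul_eq_mul, smul_eq_mul, Φ.newDeriv_apply σ i (Φ.d l x),
      Finset.mul_sum, add_comm]
    congr 1
    · ring
    · exact Finset.sum_congr rfl fun m _ => by ring
  have symm : ∀ x, ∑ l, ∑ m, (Φ.jac σ)⁻¹ l j * (Φ.jac σ)⁻¹ m i * Φ.d m (Φ.d l x) =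
      ∑ l, ∑ m, (Φ.jac σ)⁻¹ l i * (Φ.jac σ)⁻¹ m j * Φ.d m (Φ.d l x) := by
    intro x
    rw [Finset.sum_comm]
    refine Finset.sum_congr rfl fun l _ => Finset.sum_congr rfl fun m _ => ?_
    rw [Φ.comm, mul_comm ((Φ.jac σ)⁻¹ m j)]
  have hcomb : ∀ x, Φ.newDeriv σ i (Φ.newDeriv σ j x) - Φ.newDeriv σ j (Φ.newDeriv σ i x) =
      ∑ l, (Φ.newDeriv σ i ((Φ.jac σ)⁻¹ l j) - Φ.newDeriv σ j ((Φ.jac σ)⁻¹ l i)) * Φ.d l x := by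
    intro x
    rw [expand, expand, symm]
    simp only [sub_mul, Finset.sum_sub_distrib]
    ring
  have hzero : ∀ l, Φ.newDeriv σ i ((Φ.jac σ)⁻¹ l j) - Φ.newDeriv σ j ((Φ.jac σ)⁻¹ l i) = 0 := by
    refine congrFun (Matrix.eq_zero_of_mulVec_eq_zero h ?_)
    ext v
    have := hcomb (σ v)
    simp only [newDeriv_coord Φ h] at this
    rw [Matrix.mulVec, dotProduct, Pi.zero_apply]
    calc _ = ∑ l, (Φ.newDeriv σ i ((Φ.jac σ)⁻¹ l j) - Φ.newDeriv σ j ((Φ.jac σ)⁻¹ l i)) *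
            Φ.d l (σ v) := Finset.sum_congr rfl fun l _ => mul_comm _ _
      _ = 0 := by rw [← this]; split_ifs <;> simp
  rw [← sub_eq_zero, hcomb]
  simp [hzero]

/-- The frame with the same field and new coordinates. -/
noncomputable def changeCoord (σ : Fin 3 → N) (h : (Φ.jac σ).det ≠ 0) : Frame F N where
  d := Φ.newDeriv σ
  comm := Φ.newDeriv_comm h
  s := σ
  d_s := Φ.newDeriv_coord h

variable {Φ}

/-- Let `E` be generated by `σ` and the new jets of the old coordinates. The new derivatives of the
old coordinates are the entries of the inverse Jacobian, so `E` contains the Jacobian as well. By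
the chain rule `E` is stable under the old derivations, and therefore contains all old jets of `σ`.
-/
theorem totalDim_le_changeCoord (h : (Φ.jac σ).det ≠ 0) :
    Φ.totalDim σ ≤ (Φ.changeCoord σ h).totalDim Φ.s := by
  set X := Set.range (Φ.changeCoord σ h).s ∪ (Φ.changeCoord σ h).jets Φ.s
  set E := IntermediateField.adjoin F X
  have hX : X ⊆ E := IntermediateField.subset_adjoin F X
  have hσ : ∀ v, σ v ∈ E := fun v => hX (Or.inl ⟨v, rfl⟩)
  have hs : ∀ v, Φ.s v ∈ E := fun v => hX (Or.inr ⟨(v, 0), by simp⟩)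
  have hnew : ∀ j, ∀ x ∈ E, Φ.newDeriv σ j x ∈ E := by
    intro j x hx
    refine derivation_mem_adjoin _ _ (fun r => ?_) (fun x hx => ?_) hx
    · rw [Derivation.map_algebraMap]
      exact zero_mem _
    · rcases hx with ⟨v, rfl⟩ | ⟨⟨v, α⟩, rfl⟩
      · change Φ.newDeriv σ j (σ v) ∈ E
        rw [newDeriv_coord Φ h]
        split_ifs
        exacts [one_mem E, zero_mem E]
      · refine hX (Or.inr ⟨(v, α + Finsupp.single j 1), ?_⟩)
        exact iterDeriv_add_single' (Φ.changeCoord σ h).comm α j (Φ.s v)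
  have hinv : ∀ l j, (Φ.jac σ)⁻¹ l j ∈ E := by
    intro l j
    have := hnew j _ (hs l)
    rw [newDeriv_apply] at this
    simpa [Φ.d_s] using this
  have hjac : ∀ u j, Φ.d j (σ u) ∈ E := by
    intro u j
    have := inv_entry_mem E _ hinv u j
    rwa [Matrix.nonsing_inv_nonsing_inv _ (Ne.isUnit h)] at this
  have hd : ∀ j, ∀ x ∈ (E : Set N), Φ.d j x ∈ (E : Set N) := by
    intro j x hx
    rw [Φ.d_eq_sum_newDeriv h]
    exact sum_mem fun l _ => mul_mem (hjac l j) (hnew l x hx)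
  refine algRank_le_of_subset_algClosure (Set.Subset.trans ?_ (adjoin_subset_algClosure X))
  rintro _ (⟨v, rfl⟩ | ⟨⟨v, α⟩, rfl⟩)
  · exact hs v
  · exact iterDeriv_mem_of_closed Φ.comm hd (hσ v) α

variable [CharZero F] {i : GroupoidIndex} {f g g' : RatFun F} {t : Fin 3 → N}

theorem denom_s_ne_zero (Φ : Frame F N) (f : RatFun F) : aeval Φ.s (denom f) ≠ 0 := by
  rw [← coe_algebraMap, Ne, map_eq_zero]
  exact algebraMap_denom_ne_zero f

theorem isModel_self (Φ : Frame F N) (i : GroupoidIndex) (f : RatFun F) : Φ.IsModel i f f Φ.s where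
  det_ne := by
    have : (Matrix.of fun u j : Fin 3 => Φ.d j (Φ.s u)) = 1 := by
      ext u j
      simp [Φ.d_s, Matrix.one_apply]
    rw [this]
    simp
  denom_ne := Φ.denom_s_ne_zero f
  eqns := by
    cases i <;> simp [prolongedEqns, planeEqns, Φ.d_s]
  ode := by
    have := Φ.denom_s_ne_zero f
    simp only [cartan, Φ.d_s, Φ.coe_eq]
    simp
    field_simp

theorem IsModel.jac_det_ne (h : Φ.IsModel i f g σ) : (Φ.jac σ).det ≠ 0 := h.det_ne

/-- Since `x̄` and `ȳ` do not depend on `p`, the Jacobian determinant is the planar one times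
`∂p̄/∂p`. If `Dx̄` vanished, so would `Dȳ = p̄ · Dx̄`, and the planar Jacobian would be singular. -/
theorem IsModel.jac_facts (h : Φ.IsModel i f g σ) :
    Φ.d 2 (σ 2) ≠ 0 ∧ Φ.d 0 (σ 0) * Φ.d 1 (σ 1) - Φ.d 1 (σ 0) * Φ.d 0 (σ 1) ≠ 0 ∧
      Φ.d 0 (σ 0) + Φ.s 2 * Φ.d 1 (σ 0) ≠ 0 := by
  obtain ⟨h0, h1, h2⟩ := h.contact
  have hdet := h.det_ne
  rw [Matrix.det_fin_three] at hdet
  simp only [Matrix.of_apply, h0, h1] at hdet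
  have e : Φ.d 0 (σ 0) * Φ.d 1 (σ 1) * Φ.d 2 (σ 2) - Φ.d 0 (σ 0) * 0 * Φ.d 1 (σ 2) -
      Φ.d 1 (σ 0) * Φ.d 0 (σ 1) * Φ.d 2 (σ 2) + Φ.d 1 (σ 0) * 0 * Φ.d 0 (σ 2) +
      0 * Φ.d 0 (σ 1) * Φ.d 1 (σ 2) - 0 * Φ.d 1 (σ 1) * Φ.d 0 (σ 2) =
      (Φ.d 0 (σ 0) * Φ.d 1 (σ 1) - Φ.d 1 (σ 0) * Φ.d 0 (σ 1)) * Φ.d 2 (σ 2) := by ring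
  rw [e] at hdet
  refine ⟨right_ne_zero_of_mul hdet, left_ne_zero_of_mul hdet, fun h3 => ?_⟩
  rw [h3, mul_zero] at h2
  apply left_ne_zero_of_mul hdet
  linear_combination Φ.d 1 (σ 1) * h3 + Φ.d 1 (σ 0) * h2

/-- A model carries the Cartan field to a multiple of the Cartan field, with factor `Dx̄`; this is
what allows the ODE condition to be transferred between coordinates. -/
theorem IsModel.cartan_eq (h : Φ.IsModel i f g σ) (x : N) :
    Φ.cartan f x = (Φ.d 0 (σ 0) + Φ.s 2 * Φ.d 1 (σ 0)) *
      (Φ.changeCoord σ h.jac_det_ne).cartan g x := by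
  obtain ⟨h0, h1, h2⟩ := h.contact
  have hd : Φ.cartan f x = ∑ j, Φ.cartan f (σ j) * Φ.newDeriv σ j x := by
    simp only [cartan, Φ.d_eq_sum_newDeriv h.jac_det_ne _ x, Fin.sum_univ_three]
    ring
  have h3 : Φ.cartan f (σ 2) = (Φ.changeCoord σ h.jac_det_ne).coe g *
      (Φ.d 0 (σ 0) + Φ.s 2 * Φ.d 1 (σ 0)) := by
    have hne := h.denom_ne
    have ho := h.ode
    rw [coe_eq]
    change _ = aeval σ (numer g) / aeval σ (denom g) * _
    rw [show Φ.cartan f (σ 0) = Φ.d 0 (σ 0) + Φ.s 2 * Φ.d 1 (σ 0) by simp [cartan, h0]] at ho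
    field_simp
    linear_combination ho
  rw [hd, Fin.sum_univ_three, h3]
  change _ = _ * (Φ.newDeriv σ 0 x + σ 2 * Φ.newDeriv σ 1 x +
    (Φ.changeCoord σ h.jac_det_ne).coe g * Φ.newDeriv σ 2 x)
  simp only [cartan, h0, h1]
  linear_combination (-Φ.newDeriv σ 1 x) * h2

/-- This is `t ∘ σ⁻¹`: in the coordinates `σ`, the tuple `t` is a transformation from `E_g` to
`E_{g'}`. Taking for `t` the old coordinates gives the inverse of `σ`. The groupoid equations follow
from the chain rule after cancelling the factors in `jac_facts`. -/
theorem IsModel.changeCoord (h : Φ.IsModel i f g σ) (h' : Φ.IsModel i f g' t) :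
    (Φ.changeCoord σ h.jac_det_ne).IsModel i g g' t := by
  obtain ⟨h0, h1, h2⟩ := h.contact
  obtain ⟨h0', h1', h2'⟩ := h'.contact
  obtain ⟨hf0, hf1, hf2⟩ := h.jac_facts
  have hsum := fun l x => Φ.d_eq_sum_newDeriv h.jac_det_ne l x
  simp only [Fin.sum_univ_three] at hsum
  have e02 : Φ.newDeriv σ 2 (t 0) = 0 := by
    have := hsum 2 (t 0)
    rw [h0, h1, h0', zero_mul, zero_mul, zero_add, zero_add] at this
    exact (mul_eq_zero.mp this.symm).resolve_left hf0
  have e12 : Φ.newDeriv σ 2 (t 1) = 0 := by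
    have := hsum 2 (t 1)
    rw [h0, h1, h1', zero_mul, zero_mul, zero_add, zero_add] at this
    exact (mul_eq_zero.mp this.symm).resolve_left hf0
  have b00 := hsum 0 (t 0)
  have b01 := hsum 1 (t 0)
  have b10 := hsum 0 (t 1)
  have b11 := hsum 1 (t 1)
  rw [e02, mul_zero, add_zero] at b00 b01
  rw [e12, mul_zero, add_zero] at b10 b11
  refine ⟨?_, h'.denom_ne, ?_, ?_⟩
  · have : (Matrix.of fun u j : Fin 3 => Φ.newDeriv σ j (t u)) = Φ.jac t * (Φ.jac σ)⁻¹ := by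
      ext u j
      rw [Matrix.of_apply, newDeriv_apply, Matrix.mul_apply]
      exact Finset.sum_congr rfl fun l _ => mul_comm _ _
    change (Matrix.of fun u j : Fin 3 => Φ.newDeriv σ j (t u)).det ≠ 0
    rw [this, Matrix.det_mul]
    exact mul_ne_zero h'.jac_det_ne (Matrix.det_ne_zero_of_left_inverse
      (Matrix.mul_nonsing_inv _ (Ne.isUnit h.jac_det_ne)))
  · have hc : t 2 * (Φ.newDeriv σ 0 (t 0) + σ 2 * Φ.newDeriv σ 1 (t 0)) =
        Φ.newDeriv σ 0 (t 1) + σ 2 * Φ.newDeriv σ 1 (t 1) := by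
      refine mul_left_cancel₀ hf2 ?_
      rw [b00, b01, b10, b11] at h2'
      linear_combination h2' + (t 2 * Φ.newDeriv σ 1 (t 0) - Φ.newDeriv σ 1 (t 1)) * h2
    rintro e (he | he)
    · simp only [Set.mem_insert_iff, Set.mem_singleton_iff] at he
      rcases he with rfl | rfl | rfl
      · exact e02
      · exact e12
      · exact sub_eq_zero.mpr hc
    · have hp := fun e he => h.eqns e (Or.inr he)
      have hp' := fun e he => h'.eqns e (Or.inr he)
      change e ∈ planeEqns i σ t fun u j => Φ.newDeriv σ j (t u) at he
      cases i with
      | phi1 =>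
        simp only [planeEqns, Set.mem_singleton_iff, forall_eq] at hp hp' he
        rw [he]
        linear_combination hp' - hp
      | phi2 =>
        simp only [planeEqns, Set.mem_singleton_iff, forall_eq] at hp hp' he
        rw [he]
        linear_combination hp' - hp
      | phi3 =>
        simp only [planeEqns, Set.mem_insert_iff, Set.mem_singleton_iff, forall_eq_or_imp,
          forall_eq, sub_eq_zero] at hp hp' he
        rw [hp.1, hp.2] at hf1
        rw [hp.2, hp'.2, zero_mul, zero_add] at b01
        rw [zero_mul, sub_zero, one_mul] at hf1
        have e01 := (mul_eq_zero.mp b01.symm).resolve_left hf1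
        rw [hp.1, hp'.1, e01, mul_zero, add_zero, one_mul] at b00
        rcases he with rfl | rfl
        · rw [← b00, sub_self]
        · exact e01
      | phi4 =>
        simp only [planeEqns, Set.mem_insert_iff, Set.mem_singleton_iff, forall_eq_or_imp,
          forall_eq, sub_eq_zero] at hp hp' he
        rw [hp.1, hp.2, mul_zero, sub_zero, mul_one] at hf1
        rw [hp.1, hp'.1, zero_mul, add_zero] at b10
        have e10 := (mul_eq_zero.mp b10.symm).resolve_left hf1
        rw [hp.2, hp'.2, e10, mul_zero, zero_add, one_mul] at b11
        rcases he with rfl | rfl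
        · exact e10
        · rw [← b11, sub_self]
      | phi5 =>
        simp only [planeEqns, Set.mem_singleton_iff, forall_eq] at hp hp' he
        rw [hp, hp', zero_mul, zero_add] at b01
        rw [hp, zero_mul, sub_zero] at hf1
        rw [he]
        exact (mul_eq_zero.mp b01.symm).resolve_left (right_ne_zero_of_mul hf1)
      | phi6 =>
        simp only [planeEqns, Set.mem_singleton_iff, forall_eq] at hp hp' he
        rw [hp, hp', zero_mul, add_zero] at b10
        rw [hp, mul_zero, sub_zero] at hf1
        rw [he]
        exact (mul_eq_zero.mp b10.symm).resolve_left (left_ne_zero_of_mul hf1)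
      | phi7 => exact he.elim
  · refine mul_left_cancel₀ hf2 ?_
    have := h'.ode
    rw [h.cartan_eq, h.cartan_eq] at this
    linear_combination this

end Frame

/-! ### Dimension bounds from models, and the exchange of source and target. -/

section Inversion

variable {F : Type u} [Field F] [CharZero F]

/-- The transcendence degree is the supremum over independent families, and each family is realised
by a model. The summand `3` can be cancelled because it is finite, even if the dimensions are
infinite. -/
theorem isoDim_le_of_forall_model {f g f' g' : RatFun F} {i i' : GroupoidIndex}
    (h : ∀ (N : Type u) [Field N] [Algebra F N] (Φ : Frame F N) (t : Fin 3 → N),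
      Φ.IsModel i f g t → Φ.totalDim t ≤ 3 + isoDim f' g' i') :
    isoDim f g i ≤ isoDim f' g' i' := by
  refine ciSup_le' fun S => ?_
  obtain ⟨N, _, _, Φ, t, hm, hle⟩ := exists_isModel_totalDim_ge (f := f) (g := g) (i := i) S.2
  have := hle.trans (h N Φ t hm)
  rw [add_comm, add_comm 3] at this
  exact (Cardinal.add_le_add_iff_of_lt_aleph0 (by exact_mod_cast Cardinal.natCast_lt_aleph0 (n := 3))).mp this

theorem isoDim_le_swap (f g : RatFun F) (i : GroupoidIndex) : isoDim f g i ≤ isoDim g f i :=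
  isoDim_le_of_forall_model fun _ _ _ Φ _ hm =>
    (Frame.totalDim_le_changeCoord hm.jac_det_ne).trans
      (hm.changeCoord (Φ.isModel_self i f)).totalDim_le

end Inversion

theorem exists_lift_of_isTranscendenceBasis {k M W b : Type*} [Field k] [Field M] [Field W]
    [IsAlgClosed W] [Algebra k M] [Algebra k W] {y : b → M} (hy : IsTranscendenceBasis k y)
    {z : b → W} (hz : AlgebraicIndependent k z) : ∃ φ : M →ₐ[k] W, ∀ a, φ (y a) = z a := by
  let _ : Algebra (MvPolynomial b k) M := (aeval y).toRingHom.toAlgebra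
  let _ : Algebra (MvPolynomial b k) W := (aeval z).toRingHom.toAlgebra
  have : FaithfulSMul (MvPolynomial b k) M :=
    (faithfulSMul_iff_algebraMap_injective _ _).mpr hy.1
  have : FaithfulSMul (MvPolynomial b k) W :=
    (faithfulSMul_iff_algebraMap_injective _ _).mpr hz
  have hfin := hy.isAlgebraic
  have : Algebra.IsAlgebraic (MvPolynomial b k) M :=
    ⟨fun a => (hfin.1 a).of_ringHom_of_comp_eq hy.1.aevalEquiv (RingHom.id M)
      hy.1.aevalEquiv.surjective Function.injective_id rfl⟩
  let φ : M →ₐ[MvPolynomial b k] W := IsAlgClosed.lift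
  refine ⟨{ (φ : M →+* W) with commutes' := fun r => ?_ }, fun a => ?_⟩
  · have h := φ.commutes (C r)
    change φ (aeval _ (C r)) = aeval z (C r) at h
    rwa [aeval_C, aeval_C] at h
  · have h := φ.commutes (X a)
    change φ (aeval _ (X a)) = aeval z (X a) at h
    rwa [aeval_X, aeval_X] at h

/-- A free amalgam of `K` and `M` over `k`: a transcendence basis of `M` containing `x` is sent to
new variables over `K`, and the rest of `M` is algebraic over it, hence embeds in an algebraic
closure. -/
theorem exists_common_extension {k K M ι : Type u} [Field k] [Field K] [Field M] [Algebra k K]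
    [Algebra k M] {x : ι → M} (hx : AlgebraicIndependent k x) :
    ∃ (W : Type u) (_ : Field W) (_ : Algebra K W) (g : M →+* W),
      (∀ r, g (algebraMap k M r) = algebraMap K W (algebraMap k K r)) ∧
        AlgebraicIndependent K (g ∘ x) := by
  obtain ⟨b, hb, hbasis⟩ := exists_isTranscendenceBasis_superset hx.coe_range
  have hXW : AlgebraicIndependent K fun a : b =>
      algebraMap (FractionRing (MvPolynomial b K))
        (AlgebraicClosure (FractionRing (MvPolynomial b K)))
        (algebraMap (MvPolynomial b K) _ (X a)) := by
    refine (MvPolynomial.algebraicIndependent_X b K).map' (f := (IsScalarTower.toAlgHom K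
      (FractionRing (MvPolynomial b K)) (AlgebraicClosure (FractionRing (MvPolynomial b K)))).comp
      (IsScalarTower.toAlgHom K (MvPolynomial b K) (FractionRing (MvPolynomial b K)))) ?_
    exact (algebraMap (FractionRing (MvPolynomial b K))
        (AlgebraicClosure (FractionRing (MvPolynomial b K)))).injective.comp
      (IsFractionRing.injective (MvPolynomial b K) (FractionRing (MvPolynomial b K)))
  obtain ⟨φ, hφ⟩ := exists_lift_of_isTranscendenceBasis hbasis
    (hXW.restrictScalars (algebraMap k K).injective)
  refine ⟨_, inferInstance, inferInstance, φ.toRingHom, fun r => ?_, ?_⟩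
  · exact (φ.commutes r).trans (IsScalarTower.algebraMap_apply k K _ r)
  · have := hXW.comp (fun i => (⟨x i, hb ⟨i, rfl⟩⟩ : b))
      (fun i j hij => hx.injective (congrArg Subtype.val hij :))
    convert! this using 1
    ext i
    exact hφ ⟨x i, hb ⟨i, rfl⟩⟩

/-! ### Composition of models, and invariance of the dimension. -/

section Composition

variable {F : Type u} [Field F]

namespace Frame

/-- A homomorphism of fields that maps one frame to another. -/
structure Hom {M N : Type*} [Field M] [Algebra F M] [Field N] [Algebra F N] (Φ : Frame F M)
    (Ψ : Frame F N) (T : M →ₐ[F] N) : Prop where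
  map_d : ∀ j x, T (Φ.d j x) = Ψ.d j (T x)
  map_s : ∀ v, T (Φ.s v) = Ψ.s v

variable {M N : Type*} [Field M] [Algebra F M] [Field N] [Algebra F N] {Φ : Frame F M}
  {Ψ : Frame F N} {T : M →ₐ[F] N}

theorem Hom.map_iterDeriv (h : Φ.Hom Ψ T) (α : Fin 3 →₀ ℕ) (x : M) :
    T (iterDeriv Φ.d α x) = iterDeriv Ψ.d α (T x) :=
  SecondOrderODE.map_iterDeriv Φ.comm Ψ.comm T.toRingHom h.map_d α x

/-- The Taylor expansion of a framed field is a homomorphism of frames. -/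
theorem taylorFrame_hom {L : Type*} [Field L] [Algebra F L] [CharZero L] (Φ : Frame F M)
    (ev : M →ₐ[F] L) :
    Φ.Hom (taylorFrame Φ.comm ev Φ.s Φ.d_s) (taylorFrac Φ.comm ev) where
  map_d := fun j x => (powerDeriv_taylorFrac Φ.comm ev j x).symm
  map_s := fun _ => rfl

theorem aeval_map (T : M →ₐ[F] N) (t : Fin 3 → M) (P : MvPolynomial (Fin 3) F) :
    aeval (fun v => T (t v)) P = T (aeval t P) :=
  (MvPolynomial.comp_aeval_apply t T P).symm

variable [CharZero F]

theorem Hom.map_coe (h : Φ.Hom Ψ T) (f : RatFun F) : T (Φ.coe f) = Ψ.coe f := by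
  have := Ψ.algHom_eq_coe (T.comp Φ.coe) fun j => by
    rw [AlgHom.comp_apply, coe_algebraMap, aeval_X, h.map_s]
  exact congrArg (fun φ => φ f) this

theorem Hom.map_cartan (h : Φ.Hom Ψ T) (f : RatFun F) (x : M) :
    T (Φ.cartan f x) = Ψ.cartan f (T x) := by
  simp [cartan, h.map_d, h.map_s, h.map_coe]

theorem IsModel.map {i : GroupoidIndex} {f g : RatFun F} {t : Fin 3 → M}
    (hm : Φ.IsModel i f g t) (h : Φ.Hom Ψ T) : Ψ.IsModel i f g fun v => T (t v) where
  det_ne := by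
    have : (Matrix.of fun u j => Ψ.d j (T (t u))) =
        T.toRingHom.mapMatrix (Matrix.of fun u j => Φ.d j (t u)) := by
      ext u j
      exact (h.map_d j (t u)).symm
    rw [this, ← RingHom.map_det]
    exact (map_ne_zero _).mpr hm.det_ne
  denom_ne := by
    rw [aeval_map]
    exact (map_ne_zero _).mpr hm.denom_ne
  eqns := by
    have : prolongedEqns i Ψ.s (fun v => T (t v)) (fun u j => Ψ.d j (T (t u))) =
        T.toRingHom '' prolongedEqns i Φ.s t (fun u j => Φ.d j (t u)) := by
      rw [image_prolongedEqns]
      simp [h.map_d, h.map_s]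
    rw [this]
    rintro _ ⟨e, he, rfl⟩
    rw [hm.eqns e he, map_zero]
  ode := by
    rw [aeval_map, aeval_map, ← h.map_cartan, ← h.map_cartan, ← map_mul, ← map_mul, hm.ode]

/-- Over `K`, which contains `σ` and its derivatives, the old jets of `t` are rational in the new
ones. Passing from `K` to its subfield `F(σ)` then only raises the rank. -/
theorem algRank_jets_le_changeCoord {K N : Type u} [Field K] [Algebra F K] [Field N] [Algebra F N]
    {Φ : Frame F K} {Ψ : Frame F N} {T : K →ₐ[F] N} (h : Φ.Hom Ψ T) {σ : Fin 3 → K}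
    (hσ : (Φ.jac σ).det ≠ 0) (hσ' : (Ψ.jac fun v => T (σ v)).det ≠ 0) (t : Fin 3 → N) :
    let := T.toRingHom.toAlgebra
    let := (Ψ.changeCoord _ hσ').coe.toRingHom.toAlgebra
    algRank K (Ψ.jets t) ≤ algRank (RatFun F) ((Ψ.changeCoord _ hσ').jets t) := by
  let := T.toRingHom.toAlgebra
  let := (Ψ.changeCoord _ hσ').coe.toRingHom.toAlgebra
  set Ψ' := Ψ.changeCoord _ hσ' with hΨ'
  have hhom : (Φ.changeCoord σ hσ).Hom Ψ' T :=
    { map_d := by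
        intro j x
        change T (Φ.newDeriv σ j x) = Ψ.newDeriv _ j (T x)
        have hinv : (Ψ.jac fun v => T (σ v))⁻¹ = (Φ.jac σ)⁻¹.map T := by
          refine Matrix.inv_eq_left_inv ?_
          have : (Ψ.jac fun v => T (σ v)) = (Φ.jac σ).map T := by
            ext u j
            exact (h.map_d j (σ u)).symm
          rw [this, ← Matrix.map_mul, Matrix.nonsing_inv_mul _ (Ne.isUnit hσ),
            Matrix.map_one _ (map_zero T) (map_one T)]
        rw [newDeriv_apply, newDeriv_apply, hinv, map_sum]
        simp [h.map_d]
      map_s := fun _ => rfl }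
  refine le_trans ?_ (algRank_le_of_tower K (RatFun F) ?_ _)
  · set E := IntermediateField.adjoin K (Ψ'.jets t)
    have hK : ∀ r : K, T r ∈ E := E.algebraMap_mem
    have ht : ∀ v, t v ∈ E := fun v =>
      IntermediateField.subset_adjoin _ _ ⟨(v, 0), by simp⟩
    have hnew : ∀ j, ∀ x ∈ E, Ψ'.d j x ∈ E := by
      intro j x hx
      refine derivation_mem_adjoin _ _ (fun r => ?_) (fun x hx => ?_) hx
      · change Ψ'.d j (T r) ∈ E
        rw [← hhom.map_d]
        exact hK _
      · obtain ⟨⟨v, α⟩, rfl⟩ := hx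
        refine IntermediateField.subset_adjoin _ _ ⟨(v, α + Finsupp.single j 1), ?_⟩
        exact iterDeriv_add_single' Ψ'.comm α j (t v)
    have hd : ∀ j, ∀ x ∈ (E : Set N), Ψ.d j x ∈ (E : Set N) := by
      intro j x hx
      rw [Ψ.d_eq_sum_newDeriv hσ']
      refine sum_mem fun l _ => mul_mem ?_ (hnew l x hx)
      rw [← h.map_d]
      exact hK _
    refine algRank_le_of_subset_algClosure (Set.Subset.trans ?_ (adjoin_subset_algClosure _))
    rintro _ ⟨⟨v, α⟩, rfl⟩
    exact iterDeriv_mem_of_closed Ψ.comm hd (ht v) α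
  · rintro _ ⟨r, rfl⟩
    exact ⟨_, hhom.map_coe r⟩

/-- Both transformations are expanded at one common source point, with the jets of `t` independent
over the whole field of `σ`. This independence ensures that composing with `σ⁻¹` loses no
parameters. -/
theorem exists_isModel_comp {K M : Type u} [Field K] [Algebra F K] [Field M] [Algebra F M]
    {Φ : Frame F K} {σ : Fin 3 → K} {Ψ : Frame F M} {t : Fin 3 → M} {i : GroupoidIndex}
    {f g f' : RatFun F} (hσ : Φ.IsModel i f g σ) (ht : Ψ.IsModel i f f' t) :
    ∃ (N : Type u) (_ : Field N) (_ : Algebra F N) (Ω : Frame F N) (τ : Fin 3 → N),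
      Ω.IsModel i g f' τ ∧ Ψ.totalDim t ≤ Ω.totalDim τ := by
  let := Φ.coe.toRingHom.toAlgebra
  let := Ψ.coe.toRingHom.toAlgebra
  obtain ⟨B, hB, hind, -, hc⟩ :=
    exists_subset_algebraicIndependent_of_algRank (k := RatFun F) (Ψ.jets t)
  obtain ⟨W, _, _, g₀, hg₀, hW⟩ := exists_common_extension (K := K) hind
  let _ : Algebra F W := ((algebraMap K W).comp (algebraMap F K)).toAlgebra
  have : CharZero W := charZero_of_injective_algebraMap (algebraMap F W).injective
  let evK : K →ₐ[F] W := { algebraMap K W with commutes' := fun _ => rfl }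
  let evM : M →ₐ[F] W :=
    { g₀ with
      commutes' := fun c => by
        have := hg₀ (algebraMap F _ c)
        change g₀ (Ψ.coe _) = algebraMap K W (Φ.coe _) at this
        rwa [AlgHom.commutes, AlgHom.commutes] at this }
  have hK := Φ.taylorFrame_hom evK
  have hM := Ψ.taylorFrame_hom evM
  have hev : ∀ v, evM (Ψ.s v) = evK (Φ.s v) := by
    intro v
    have := hg₀ (algebraMap (MvPolynomial (Fin 3) F) (RatFun F) (X v))
    change g₀ (Ψ.coe _) = algebraMap K W (Φ.coe _) at this
    rwa [coe_algebraMap, coe_algebraMap, aeval_X, aeval_X] at this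
  set TK := taylorFrac Φ.comm evK
  set TM := taylorFrac Ψ.comm evM
  set Ω := taylorFrame Φ.comm evK Φ.s Φ.d_s
  have hs : ∀ v, TM (Ψ.s v) = TK (Φ.s v) := by
    intro v
    -- The two expansions of a source coordinate have the same derivatives and, because the
    -- embeddings agree on `F(x, y, p)`, the same constant term.
    have : taylor Ψ.comm evM (Ψ.s v) = taylor Φ.comm evK (Φ.s v) := by
      refine MvPowerSeries.pderiv.ext (fun j => ?_) ?_
      · rw [pderiv_taylor, pderiv_taylor, Ψ.d_s, Φ.d_s]
        split_ifs <;> simp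
      · rw [constantCoeff_taylor, constantCoeff_taylor, hev]
    exact congrArg (algebraMap _ (PowerFrac W)) this
  have hM' : Ψ.Hom Ω TM := ⟨hM.map_d, hs⟩
  have hmσ := hσ.map hK
  have hmt := ht.map hM'
  refine ⟨_, _, _, _, _, hmσ.changeCoord hmt, ?_⟩
  rw [totalDim_eq, totalDim_eq]
  gcongr
  refine le_trans ?_ (algRank_jets_le_changeCoord hK hσ.jac_det_ne hmσ.jac_det_ne _)
  let := TK.toRingHom.toAlgebra
  -- Taking constant terms turns a relation among the series into the same relation among their
  -- values in `W`, where independence over `K` is known.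
  have hind' : AlgebraicIndependent K fun b : B => TM b := by
    rw [algebraicIndependent_iff] at hW ⊢
    intro p hp
    refine hW p ?_
    have e : ∀ p : MvPolynomial B K, aeval (fun b : B => TM b) p =
        algebraMap (MvPowerSeries (Fin 3) W) (PowerFrac W)
          (eval₂Hom (taylor Φ.comm evK).toRingHom (fun b : B => taylor Ψ.comm evM b) p) := by
      intro p
      induction p using MvPolynomial.induction_on with
      | C r =>
        rw [aeval_C, eval₂Hom_C]
        rfl
      | add p q hp hq => simp only [map_add, hp, hq]
      | mul_X q v hq =>
        rw [map_mul, map_mul, map_mul, hq, aeval_X, eval₂Hom_X']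
        rfl
    have e' : ∀ p : MvPolynomial B K, MvPowerSeries.constantCoeff
          (eval₂Hom (taylor Φ.comm evK).toRingHom (fun b : B => taylor Ψ.comm evM b) p) =
        aeval (g₀ ∘ ((↑) : B → M)) p := by
      intro p
      induction p using MvPolynomial.induction_on with
      | C r =>
        rw [aeval_C, eval₂Hom_C]
        exact constantCoeff_taylor Φ.comm r
      | add p q hp hq => simp only [map_add, hp, hq]
      | mul_X q v hq =>
        rw [map_mul, map_mul, map_mul, hq, aeval_X, eval₂Hom_X', constantCoeff_taylor]
        rfl
    rw [e, map_eq_zero_iff _ (IsFractionRing.injective _ (PowerFrac W))] at hp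
    rw [← e', hp, map_zero]
  rw [← hc, ← Cardinal.mk_range_eq _ hind'.injective]
  refine cardinalMk_le_algRank hind'.coe_range ?_
  rintro _ ⟨b, rfl⟩
  obtain ⟨⟨v, α⟩, hv⟩ := hB b.2
  refine ⟨(v, α), ?_⟩
  change iterDeriv Ω.d α (TM (t v)) = TM b
  rw [← hv, hM'.map_iterDeriv]

end Frame

variable [CharZero F]

theorem isoDim_le_of_isModel {K : Type u} [Field K] [Algebra F K] {Φ : Frame F K}
    {σ : Fin 3 → K} {i : GroupoidIndex} {f g : RatFun F} (hσ : Φ.IsModel i f g σ) (f' : RatFun F) :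
    isoDim f f' i ≤ isoDim g f' i :=
  isoDim_le_of_forall_model fun _ _ _ _ _ hm => by
    obtain ⟨N, _, _, Ω, τ, h, hle⟩ := Frame.exists_isModel_comp hσ hm
    exact hle.trans h.totalDim_le

/-- `symDim f i` is `isoDim f f i` by definition. Its target and source are replaced by `g` in turn:
from `(f, f)` to `(g, f)`, swapped to `(f, g)`, then to `(g, g)`. -/
theorem symDim_le_of_isModel {K : Type u} [Field K] [Algebra F K] {Φ : Frame F K}
    {σ : Fin 3 → K} {i : GroupoidIndex} {f g : RatFun F} (hσ : Φ.IsModel i f g σ) :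
    symDim f i ≤ symDim g i :=
  (isoDim_le_of_isModel hσ f).trans ((isoDim_le_swap g f i).trans (isoDim_le_of_isModel hσ g))

theorem symDim_eq_of_isModel {K : Type u} [Field K] [Algebra F K] {Φ : Frame F K}
    {σ : Fin 3 → K} {i : GroupoidIndex} {f g : RatFun F} (hσ : Φ.IsModel i f g σ) :
    symDim f i = symDim g i :=
  le_antisymm (symDim_le_of_isModel hσ)
    (symDim_le_of_isModel (hσ.changeCoord (Φ.isModel_self i f)))

end Composition

/-! ### The differential algebra of analytic functions on an open set. -/

section AnalyticFunctions

variable (F : Type u) [Field F] [Algebra F ℂ] {V : Set (Fin 3 → ℂ)}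

/-- The extension by zero of a function on `V`. -/
noncomputable def extendZero (a : V → ℂ) : (Fin 3 → ℂ) → ℂ := Function.extend Subtype.val a 0

theorem extendZero_apply (a : V → ℂ) (v : V) : extendZero a v = a v :=
  Subtype.val_injective.extend_apply a 0 v

theorem eqOn_extendZero {a : V → ℂ} {b : (Fin 3 → ℂ) → ℂ} (h : ∀ v : V, a v = b v) :
    Set.EqOn (extendZero a) b V := fun v hv => (extendZero_apply a ⟨v, hv⟩).trans (h ⟨v, hv⟩)

/-- The algebra of analytic functions on an open set. -/
def analyticAlgebra (hV : IsOpen V) : Subalgebra F (V → ℂ) where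
  carrier := {a | AnalyticOnNhd ℂ (extendZero a) V}
  add_mem' := fun {a b} ha hb => (ha.add hb).congr hV
    (eqOn_extendZero fun v => by simp [extendZero_apply]).symm
  mul_mem' := fun {a b} ha hb => (ha.mul hb).congr hV
    (eqOn_extendZero fun v => by simp [extendZero_apply]).symm
  algebraMap_mem' := fun c => (analyticOnNhd_const (v := algebraMap F ℂ c)).congr hV
    (eqOn_extendZero fun v => rfl).symm

variable {F}

/-- The restriction to `V` of a function that is analytic on `V`. -/
def analyticMk (hV : IsOpen V) (b : (Fin 3 → ℂ) → ℂ) (hb : AnalyticOnNhd ℂ b V) : analyticAlgebra F hV :=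
  ⟨fun v => b v, hb.congr hV (eqOn_extendZero fun _ => rfl).symm⟩

theorem fderiv_extendZero (hV : IsOpen V) {a : V → ℂ} {b : (Fin 3 → ℂ) → ℂ} (h : ∀ v : V, a v = b v) (v : V) :
    fderiv ℂ (extendZero a) v = fderiv ℂ b v :=
  ((eqOn_extendZero h).eventuallyEq_of_mem (hV.mem_nhds v.2)).fderiv_eq

variable (hV : IsOpen V)

theorem differentiableAt_extendZero (a : analyticAlgebra F hV) (v : V) :
    DifferentiableAt ℂ (extendZero a.1) v :=
  (a.2 v v.2).differentiableAt

/-- The partial derivatives of analytic functions. -/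
noncomputable def analyticDeriv (j : Fin 3) :
    Derivation F (analyticAlgebra F hV) (analyticAlgebra F hV) :=
  Derivation.mk'
    { toFun := fun a => analyticMk hV (fun v => fderiv ℂ (extendZero a.1) v (Pi.single j 1))
        fun v hv => ((ContinuousLinearMap.apply ℂ ℂ (Pi.single j 1 : Fin 3 → ℂ)).analyticAt _).comp
          (a.2.fderiv v hv)
      map_add' := fun a b => Subtype.ext <| funext fun v => by
        change fderiv ℂ (extendZero (a.1 + b.1)) v (Pi.single j 1) =
          fderiv ℂ (extendZero a.1) v (Pi.single j 1) + fderiv ℂ (extendZero b.1) v (Pi.single j 1)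
        rw [fderiv_extendZero hV (b := extendZero a.1 + extendZero b.1)
          (fun v => by simp [extendZero_apply]), fderiv_add (differentiableAt_extendZero hV a v)
          (differentiableAt_extendZero hV b v)]
        rfl
      map_smul' := fun c a => Subtype.ext <| funext fun v => by
        change fderiv ℂ (extendZero (c • a.1)) v (Pi.single j 1) =
          c • fderiv ℂ (extendZero a.1) v (Pi.single j 1)
        rw [fderiv_extendZero hV (b := fun w => algebraMap F ℂ c * extendZero a.1 w)
          (fun v => by simp [extendZero_apply, Algebra.smul_def]),
          fderiv_const_mul (differentiableAt_extendZero hV a v), Algebra.smul_def]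
        rfl }
    (fun a b => Subtype.ext <| funext fun v => by
      change fderiv ℂ (extendZero (a.1 * b.1)) v (Pi.single j 1) =
        a.1 v * fderiv ℂ (extendZero b.1) v (Pi.single j 1) +
          b.1 v * fderiv ℂ (extendZero a.1) v (Pi.single j 1)
      rw [fderiv_extendZero hV (b := extendZero a.1 * extendZero b.1)
        (fun v => by simp [extendZero_apply]), fderiv_mul (differentiableAt_extendZero hV a v)
        (differentiableAt_extendZero hV b v), extendZero_apply, extendZero_apply]
      rfl)

theorem analyticDeriv_apply (j : Fin 3) (a : analyticAlgebra F hV) (v : V) :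
    (analyticDeriv hV j a).1 v = fderiv ℂ (extendZero a.1) v (Pi.single j 1) := rfl

theorem analyticDeriv_mk (j : Fin 3) (b : (Fin 3 → ℂ) → ℂ) (hb : AnalyticOnNhd ℂ b V) (v : V) :
    (analyticDeriv hV j (analyticMk (F := F) hV b hb)).1 v = fderiv ℂ b v (Pi.single j 1) := by
  rw [analyticDeriv_apply, analyticMk, fderiv_extendZero hV (b := b) fun _ => rfl]

theorem analyticDeriv_comm (i j : Fin 3) (a : analyticAlgebra F hV) :
    analyticDeriv hV i (analyticDeriv hV j a) = analyticDeriv hV j (analyticDeriv hV i a) := by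
  have key : ∀ i j (v : V), (analyticDeriv hV i (analyticDeriv hV j a)).1 v =
      fderiv ℂ (fderiv ℂ (extendZero a.1)) v (Pi.single i 1) (Pi.single j 1) := by
    intro i j v
    refine (analyticDeriv_mk (F := F) hV i _ _ v).trans ?_
    rw [fderiv_clm_apply (a.2.fderiv v v.2).differentiableAt (differentiableAt_const _)]
    simp
  refine Subtype.ext <| funext fun v => ?_
  rw [key, key]
  have hsymm : IsSymmSndFDerivAt ℂ (extendZero a.1) v :=
    (a.2 v v.2).contDiffAt.isSymmSndFDerivAt (n := ⊤) (by simp)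
  exact hsymm _ _

end AnalyticFunctions

/-! ### From an analytic equivalence to a model. -/

section AnalyticModel

variable {F : Type u} [Field F] [Algebra F ℂ] {V : Set (Fin 3 → ℂ)} (hV : IsOpen V)

/-- Evaluation of analytic functions at a point. -/
def analyticEval (v : V) : analyticAlgebra F hV →ₐ[F] ℂ :=
  (Pi.evalAlgHom F (fun _ : V => ℂ) v).comp (analyticAlgebra F hV).val

theorem analyticEval_deriv_mk (j : Fin 3) (b : (Fin 3 → ℂ) → ℂ) (hb : AnalyticOnNhd ℂ b V)
    (v : V) : analyticEval hV v (analyticDeriv hV j (analyticMk (F := F) hV b hb)) =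
      fderiv ℂ b v (Pi.single j 1) := analyticDeriv_mk hV j b hb v

theorem analyticAlgebra_ext {a b : analyticAlgebra F hV}
    (h : ∀ v, analyticEval hV v a = analyticEval hV v b) : a = b :=
  Subtype.ext (funext h)

theorem analyticOnNhd_coord {φ : (Fin 3 → ℂ) → (Fin 3 → ℂ)} (hφ : AnalyticOnNhd ℂ φ V)
    (w : Fin 3) : AnalyticOnNhd ℂ (fun v => φ v w) V := fun v hv =>
  ((ContinuousLinearMap.proj (R := ℂ) (φ := fun _ : Fin 3 => ℂ) w).analyticAt _).comp (hφ v hv)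

variable {i : GroupoidIndex} {f g : RatFun F} {φ : (Fin 3 → ℂ) → (Fin 3 → ℂ)}

theorem fderiv_coord (h : IsLocalEquivalence i f g V φ) (v : V) (w : Fin 3) (e : Fin 3 → ℂ) :
    fderiv ℂ (fun v => φ v w) v e = fderiv ℂ φ v e w :=
  congrArg (fun L => L e) (fderiv_apply (h.analytic v v.2).differentiableAt w)

/-- The image of the spanning vector is a multiple of `(1, p̄, g)`; the multiple is read off from
its first component. -/
theorem IsLocalEquivalence.cartan (h : IsLocalEquivalence i f g V φ) (v : V) :
    let D := fun w => fderiv ℂ φ v (Pi.single 0 1) w + v.1 2 * fderiv ℂ φ v (Pi.single 1 1) w +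
      evalAt f v * fderiv ℂ φ v (Pi.single 2 1) w
    D 2 = evalAt g (φ v) * D 0 := by
  intro D
  have hD : fderiv ℂ φ v ![1, v.1 2, evalAt f v] = D := by
    have : (![1, v.1 2, evalAt f v] : Fin 3 → ℂ) = Pi.single 0 1 + v.1 2 • Pi.single 1 1 +
        evalAt f v • Pi.single 2 1 := by
      ext w
      fin_cases w <;> simp
    rw [this]
    ext w
    simp [D]
  have hm : D ∈ cartanLine g (φ v) := by
    rw [← h.map_line v v.2, ← hD]
    exact Submodule.mem_map_of_mem (Submodule.mem_span_singleton_self _)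
  obtain ⟨c, hc⟩ := Submodule.mem_span_singleton.mp hm
  rw [← hc]
  simp [mul_comm]

/-- The set `V` need not be connected, so the analytic functions may have zero divisors; Taylor
expansion at one point lands in a field. Any point of `V` will do, because the coordinates of a
frame are always independent. -/
theorem exists_isModel_of_isLocalEquivalence [CharZero F] (h : IsLocalEquivalence i f g V φ) :
    ∃ (K : Type u) (_ : Field K) (_ : Algebra F K) (Φ : Frame F K) (σ : Fin 3 → K),
      Φ.IsModel i f g σ := by
  have hV := h.isOpen
  obtain ⟨v₀, hv₀⟩ := h.nonempty
  -- The lift of `ℂ` only puts the model in the universe of `F`.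
  let ev : analyticAlgebra F hV →ₐ[F] ULift.{u} ℂ :=
    (ULift.algEquiv (R := F) (A := ℂ)).symm.toAlgHom.comp (analyticEval hV ⟨v₀, hv₀⟩)
  have hev : ∀ a, ev a = 0 → analyticEval hV ⟨v₀, hv₀⟩ a = 0 := fun a ha =>
    (map_eq_zero_iff _ (ULift.algEquiv (R := F) (A := ℂ)).symm.injective).mp ha
  have : CharZero (ULift.{u} ℂ) := charZero_of_injective_algebraMap (algebraMap F _).injective
  let s : Fin 3 → analyticAlgebra F hV := fun j =>
    analyticMk hV (fun v => v j) (analyticOnNhd_coord analyticOnNhd_id j)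
  let σ : Fin 3 → analyticAlgebra F hV := fun j =>
    analyticMk hV (fun v => φ v j) (analyticOnNhd_coord h.analytic j)
  have hs : ∀ i j, analyticDeriv hV j (s i) = if i = j then 1 else 0 := by
    intro i j
    refine analyticAlgebra_ext hV fun v => ?_
    rw [analyticEval_deriv_mk]
    have : fderiv ℂ (fun v : Fin 3 → ℂ => v i) v = ContinuousLinearMap.proj i :=
      (ContinuousLinearMap.proj (R := ℂ) (φ := fun _ : Fin 3 => ℂ) i).fderiv
    rw [this, ContinuousLinearMap.proj_apply, Pi.single_apply]
    split_ifs <;> simp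
  have hevσ : ∀ v u j, analyticEval hV v (analyticDeriv hV j (σ u)) =
      fderiv ℂ φ v (Pi.single j 1) u := fun v u j =>
    (analyticEval_deriv_mk hV _ _ _ v).trans (fderiv_coord h v u _)
  have hpoly : ∀ v P, analyticEval hV v (aeval σ P) = aeval (φ v) P := fun v P =>
    MvPolynomial.comp_aeval_apply σ (analyticEval hV v) P
  have hpoly' : ∀ (v : V) P, analyticEval hV v (aeval s P) = aeval v.1 P := fun v P =>
    MvPolynomial.comp_aeval_apply s (analyticEval hV v) P
  let T := taylorFrac (analyticDeriv_comm hV) ev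
  let Φ := taylorFrame (analyticDeriv_comm hV) ev s hs
  have hT : ∀ a, T a = 0 → analyticEval hV ⟨v₀, hv₀⟩ a = 0 := fun a ha =>
    hev a (ev_eq_zero_of_taylorFrac_eq_zero _ _ ha)
  have hTd : ∀ j a, Φ.d j (T a) = T (analyticDeriv hV j a) :=
    powerDeriv_taylorFrac (analyticDeriv_comm hV) ev
  have hTp : ∀ P, aeval (fun u => T (σ u)) P = T (aeval σ P) := fun P =>
    (MvPolynomial.comp_aeval_apply σ T P).symm
  have hTs : ∀ P, aeval Φ.s P = T (aeval s P) := fun P =>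
    (MvPolynomial.comp_aeval_apply s T P).symm
  refine ⟨_, inferInstance, inferInstance, Φ, fun u => T (σ u), ?_, ?_, ?_, ?_⟩
  · have e : (Matrix.of fun u j => Φ.d j (T (σ u))) =
        T.toRingHom.mapMatrix (Matrix.of fun u j => analyticDeriv hV j (σ u)) := by
      ext u j
      exact hTd j (σ u)
    rw [e, ← RingHom.map_det]
    intro h0
    have h1 := hT _ h0
    have h2 : analyticEval hV ⟨v₀, hv₀⟩ (Matrix.of fun u j => analyticDeriv hV j (σ u)).det =
        (fderiv ℂ φ v₀).det := by
      rw [← AlgHom.coe_toRingHom, RingHom.map_det, ContinuousLinearMap.det,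
        ← LinearMap.det_toMatrix']
      congr 1
      ext u j
      exact hevσ _ u j
    exact h.invertible v₀ hv₀ (h2.symm.trans h1)
  · rw [hTp]
    intro h0
    have := hT _ h0
    rw [hpoly] at this
    exact h.defined_target v₀ hv₀ this
  · have e : prolongedEqns i Φ.s (fun u => T (σ u)) (fun u j => Φ.d j (T (σ u))) =
        T.toRingHom '' prolongedEqns i s σ (fun u j => analyticDeriv hV j (σ u)) := by
      rw [image_prolongedEqns]
      simp only [hTd]
      rfl
    rw [e]
    rintro _ ⟨q, hq, rfl⟩
    have : q = 0 := by
      refine analyticAlgebra_ext hV fun v => ?_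
      rw [map_zero]
      have h1 := Set.mem_image_of_mem (analyticEval hV v).toRingHom hq
      rw [image_prolongedEqns] at h1
      refine h.mem_groupoid v v.2 _ ?_
      simp only [AlgHom.toRingHom_eq_coe, RingHom.coe_coe, hevσ] at h1
      exact h1
    rw [this, map_zero]
  -- The Cartan field times the denominator of `f`, so that no division is needed inside the
  -- algebra.
  · let D : analyticAlgebra F hV → analyticAlgebra F hV := fun a =>
      aeval s (denom f) * (analyticDeriv hV 0 a + s 2 * analyticDeriv hV 1 a) +
        aeval s (numer f) * analyticDeriv hV 2 a
    have hD : ∀ a, aeval Φ.s (denom f) * Φ.cartan f (T a) = T (D a) := by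
      intro a
      have hne := Φ.denom_s_ne_zero f
      rw [Frame.cartan, Frame.coe_eq]
      field_simp
      simp only [hTd, D, map_add, map_mul, hTs]
      change _ * (_ + T (s 2) * _) + _ = _
      ring
    have key : aeval σ (denom g) * D (σ 2) = aeval σ (numer g) * D (σ 0) := by
      refine analyticAlgebra_ext hV fun v => ?_
      simp only [D, map_mul, map_add, hpoly, hpoly', hevσ]
      have hc := h.cartan v
      have hf : aeval v.1 (denom f) ≠ 0 := h.defined_source v v.2
      have hg : aeval (φ v) (denom g) ≠ 0 := h.defined_target v v.2
      change _ * (_ * (_ + v.1 2 * _) + _) = _ * (_ * (_ + v.1 2 * _) + _)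
      simp only [evalAt] at hc
      field_simp at hc
      linear_combination hc
    refine mul_left_cancel₀ (Φ.denom_s_ne_zero f) ?_
    rw [mul_left_comm, mul_left_comm (aeval Φ.s (denom f)), hD, hD, hTp, hTp, ← map_mul, ← map_mul,
      key]

end AnalyticModel

/-! ### Inclusions among the seven groupoids. -/

section Inclusions

/-- The inclusion of one of the seven groupoids in another one. -/
def IncludedIn (i j : GroupoidIndex) : Prop :=
  ∀ (F : Type u) [Field F] (N : Type u) [Field N] [Algebra F N] (Φ : Frame F N) (t : Fin 3 → N),
    (∀ e ∈ planeEqns i Φ.s t fun u j => Φ.d j (t u), e = 0) →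
      ∀ e ∈ planeEqns j Φ.s t fun u j => Φ.d j (t u), e = 0

theorem includedIn_phi1_phi3 : IncludedIn.{u} .phi1 .phi3 := by
  intro F _ N _ _ Φ t h
  simp only [planeEqns, Set.mem_insert_iff, Set.mem_singleton_iff, forall_eq_or_imp,
    forall_eq, sub_eq_zero] at h ⊢
  simp [h, Φ.d_s]

theorem includedIn_phi2_phi4 : IncludedIn.{u} .phi2 .phi4 := by
  intro F _ N _ _ Φ t h
  simp only [planeEqns, Set.mem_insert_iff, Set.mem_singleton_iff, forall_eq_or_imp,
    forall_eq, sub_eq_zero] at h ⊢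
  simp [h, Φ.d_s]

theorem includedIn_phi3_phi5 : IncludedIn.{u} .phi3 .phi5 := by
  intro F _ N _ _ Φ t h
  simp_all [planeEqns]

theorem includedIn_phi4_phi6 : IncludedIn.{u} .phi4 .phi6 := by
  intro F _ N _ _ Φ t h
  simp_all [planeEqns]

theorem includedIn_phi7 (i : GroupoidIndex) : IncludedIn.{u} i .phi7 := by
  intro F _ N _ _ Φ t h
  simp [planeEqns]

theorem IncludedIn.trans {i j l : GroupoidIndex} (h : IncludedIn.{u} i j)
    (h' : IncludedIn.{u} j l) : IncludedIn.{u} i l :=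
  fun F _ N _ _ Φ t hi => h' F N Φ t (h F N Φ t hi)

theorem IncludedIn.refl (i : GroupoidIndex) : IncludedIn.{u} i i :=
  fun _ _ _ _ _ _ _ h => h

end Inclusions

/-! ### Comparison of the dimensions and of the signatures. -/

section Signatures

variable {F : Type u} [Field F]

theorem Frame.IsModel.mono [CharZero F] {N : Type u} [Field N] [Algebra F N] {Φ : Frame F N}
    {f g : RatFun F} {t : Fin 3 → N} {i j : GroupoidIndex} (h : Φ.IsModel i f g t)
    (hij : IncludedIn.{u} i j) : Φ.IsModel j f g t where
  det_ne := h.det_ne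
  denom_ne := h.denom_ne
  eqns := by
    rintro e (he | he)
    · exact h.eqns e (Or.inl he)
    · exact hij F N Φ t (fun e he => h.eqns e (Or.inr he)) e he
  ode := h.ode

/-- Models for the smaller groupoid are models for the larger one, so the differential ideals need
not be compared directly. -/
theorem symDim_mono [CharZero F] (f : RatFun F) {i j : GroupoidIndex} (hij : IncludedIn.{u} i j) :
    symDim f i ≤ symDim f j :=
  isoDim_le_of_forall_model fun _ _ _ _ _ h => (h.mono hij).totalDim_le

theorem symDim_eq_of_isLocalEquivalence [Algebra F ℂ] {f g : RatFun F} {i j : GroupoidIndex}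
    {V : Set (Fin 3 → ℂ)} {φ : (Fin 3 → ℂ) → (Fin 3 → ℂ)} (h : IsLocalEquivalence i f g V φ)
    (hij : IncludedIn.{u} i j) : symDim f j = symDim g j := by
  have : CharZero F := (algebraMap F ℂ).charZero
  obtain ⟨K, _, _, Φ, σ, hm⟩ := exists_isModel_of_isLocalEquivalence h
  exact symDim_eq_of_isModel (hm.mono hij)

end Signatures

end SecondOrderODE

theorem lemma2 {F : Type*} [Field F] [Algebra F ℂ] (f fbar : SecondOrderODE.RatFun F)
    (h : SecondOrderODE.StronglyEquivalent f fbar) :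
    SecondOrderODE.SignaturesMatch (SecondOrderODE.signature f)
      (SecondOrderODE.signature fbar) := by
  open SecondOrderODE in
  have : CharZero F := (algebraMap F ℂ).charZero
  obtain ⟨i, ⟨V, φ, hφ⟩, h0⟩ := h
  -- For groupoids above `Φᵢ`, the equivalence still belongs to the groupoid.
  have heq : ∀ {j}, IncludedIn i j → symDim f j = symDim fbar j := fun hij =>
    symDim_eq_of_isLocalEquivalence hφ hij
  have hf0 : symDim f i = 0 := (heq (IncludedIn.refl i)).trans h0
  -- For groupoids below `Φᵢ`, where the equivalence may be lost, both dimensions are squeezed to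
  -- zero.
  have hzero : ∀ {j}, IncludedIn j i → symDim f j = symDim fbar j := fun hji =>
    (nonpos_iff_eq_zero.mp (hf0 ▸ symDim_mono f hji)).trans
      (nonpos_iff_eq_zero.mp (h0 ▸ symDim_mono fbar hji)).symm
  refine ⟨heq (includedIn_phi7 i), ?_⟩
  have h13 := includedIn_phi1_phi3
  have h35 := includedIn_phi3_phi5
  have h24 := includedIn_phi2_phi4
  have h46 := includedIn_phi4_phi6
  simp only [signature, Prod.mk.injEq]
  cases i with
  | phi1 => exact Or.inl ⟨heq (.refl _), heq h13, heq (h13.trans h35)⟩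
  | phi2 => exact Or.inr ⟨heq (.refl _), heq h24, heq (h24.trans h46)⟩
  | phi3 => exact Or.inl ⟨hzero h13, heq (.refl _), heq h35⟩
  | phi4 => exact Or.inr ⟨hzero h24, heq (.refl _), heq h46⟩
  | phi5 => exact Or.inl ⟨hzero (h13.trans h35), hzero h35, heq (.refl _)⟩
  | phi6 => exact Or.inr ⟨hzero (h24.trans h46), hzero h46, heq (.refl _)⟩
  | phi7 => exact Or.inl ⟨hzero (includedIn_phi7 _), hzero (includedIn_phi7 _),
      hzero (includedIn_phi7 _)⟩
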